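/- **Setting.** Let $G=(V,E)$ be an infinite connected simple graph with $\Delta:=\sup_x\deg(x)<\infty$, let $\delta:=\inf_x\deg(x)$, and let $j$ be an integer with $1\le j\le\delta$. Let $(L_x(t))_{x\in V,\,t\in\mathbb N_{\ge1}}$ be independent random variables, uniform on $[0,1]$, on a probability space with measure $\mathbb P$. For $\eta\in\{0,1\}^V$ put $c_x(\eta)=\sum_{y\sim x}\eta_y$. For $\varepsilon\ge 0$ let $\Xi^{\mathbf 1}$ be one of the following two discrete-time processes on $\{0,1\}^V$ started from $\Xi^{\mathbf 1}(0)\equiv 1$: at each time $t\ge 1$ and vertex $x$, the new value is $0$ if $L_x(t)<\varepsilon$; if $L_x(t)\ge\varepsilon$, it is - $\mathbf 1\{c_x(\Xi^{\mathbf 1}(t-1))\ge j\}$ for the $j$-threshold Consensus Process ($\Xi=\chi$); - $\max\{\Xi_x^{\mathbf 1}(t-1),\mathbf 1\{c_x(\Xi^{\mathbf 1}(t-1))\ge j\}\}$ for $j$-neighbour Bootstrap Percolation with $\varepsilon$-noise ($\Xi=\omega$). For finite $K\subset V$, let $\partial_EK$ be the set of edges with exactly one endpoint in $K$ and $\partial_VK$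 the set of vertices outside $K$ with a neighbour in $K$. Let $\Phi_E$ and $\Phi_V$ be the infima of $|\partial_EK|/|K|$ and $|\partial_VK|/|K|$ over finite nonempty $K\subset V$. Let $S_k(r)$ be the set of vertices at distance exactly $k$ from $r$, $N(x)$ the set of neighbours of $x$, and let $\bar j$ be the largest $i\in\mathbb N=\{0,1,\dots\}$ for which there is $r\in V$ with $|S_{k+1}(r)\cap N(x)|\ge i$ for all $k\in\mathbb N$ and $x\in S_k(r)$. - $j$ is *$\omega$-good* if (a) $j<\Phi_E+1$ or (b) $j\le\bar j$. - $j$ is *$\chi$-good* if (i) $2j<3\Phi_E-\Delta+2$, or (ii) $G$ is bipartite and $j<\Phi_E+1$, or (iii) $j<\Phi_V$, or (iv) $G$ is the $d$-regular tree for some $d\ge2$ and $j<d$. Let $G\boxtimes\mathbb N$ be the graph on $V\times\mathbb N$ in which two distinct points $(y,s)$ and $(y',s')$ are adjacent if and only if ($y=y'$ or $y\sim y'$) and $|s-s'|\le1$. For $(x,t)\in V\times\mathbb N$ let $\mathcal C_{x,t}$ be the connected component containing $(x,t)$ of the subgraph of $G\boxtimes\mathbb N$ induced by $\{(y,s)\in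 V\times\mathbb N:\Xi^{\mathbf 1}_y(s)=0\}$, with $\mathcal C_{x,t}=\emptyset$ if $\Xi_x^{\mathbf 1}(t)=1$. Diameters are taken in the graph distance of $G\boxtimes\mathbb N$, may be $+\infty$, and $\operatorname{diam}(\emptyset)=-\infty$. **Proposition 2.9.** Assume that $j$ is $\Xi$-good. Then there exist $c>0$ and $\tilde\varepsilon>0$, depending only on $G$, $j$ and the choice of the process ($\chi$ or $\omega$), such that for every $(x,t)\in V\times\mathbb N$, every $\varepsilon\in[0,\tilde\varepsilon]$ and every integer $\ell\ge0$, $$\mathbb P\bigl[\operatorname{diam}(\mathcal C_{x,t})\ge\ell\bigr]\le\varepsilon^{c(\ell+1)}.$$ -/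

import Mathlib

open MeasureTheory ProbabilityTheory

namespace NoisyThreshold

universe u v

section Graph

variable {V : Type u} (G : SimpleGraph V)

/-- The maximum degree `Δ(G) = sup deg`; used only for graphs of bounded degree. -/
noncomputable def maxDeg [G.LocallyFinite] : ℕ := ⨆ x : V, G.degree x

/-- The minimum degree `δ(G) = inf deg`. -/
noncomputable def minDeg [G.LocallyFinite] : ℕ := ⨅ x : V, G.degree x

/-- The edge boundary of `K`: the edges with exactly one endpoint in `K`. -/
def edgeBdry (K : Set V) : Set (Sym2 V) :=
  {e | ∃ x ∈ K, ∃ y ∉ K, G.Adj x y ∧ e = s(x, y)}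

/-- The (outer) vertex boundary of `K`: the vertices outside `K` with a neighbour in `K`. -/
def vertexBdry (K : Set V) : Set V :=
  {x | x ∉ K ∧ ∃ y ∈ K, G.Adj x y}

/-- The edge expansion constant: the infimum of `|∂_E K| / |K|` over finite nonempty `K`. -/
noncomputable def edgeExpansion : ℝ :=
  ⨅ K : {K : Finset V // K.Nonempty},
    ((edgeBdry G (K.1 : Set V)).ncard : ℝ) / (K.1.card : ℝ)

/-- The vertex expansion constant: the infimum of `|∂_V K| / |K|` over finite nonempty `K`. -/
noncomputable def vertexExpansion : ℝ :=
  ⨅ K : {K : Finset V // K.Nonempty},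
    ((vertexBdry G (K.1 : Set V)).ncard : ℝ) / (K.1.card : ℝ)

/-- The sphere of radius `k` around `r` in the graph distance (of a connected graph). -/
def sphere (r : V) (k : ℕ) : Set V := {y | G.dist r y = k}

/-- The largest `j` such that, for some root `r`, every vertex of every sphere `S_k(r)` has at
least `j` neighbours in `S_{k+1}(r)`. For locally finite connected graphs on a nonempty vertex set
the supremum of this set is a maximum. -/
noncomputable def jBar : ℕ :=
  sSup {j : ℕ | ∃ r : V, ∀ k : ℕ, ∀ x ∈ sphere G r k,
    j ≤ (sphere G r (k + 1) ∩ G.neighborSet x).ncard}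

/-- The strong product of two graphs. -/
def strongProduct {W : Type v} (H : SimpleGraph W) : SimpleGraph (V × W) where
  Adj p q := (p.1 = q.1 ∧ H.Adj p.2 q.2) ∨ (G.Adj p.1 q.1 ∧ p.2 = q.2) ∨
    (G.Adj p.1 q.1 ∧ H.Adj p.2 q.2)
  symm := ⟨by
    rintro p q (⟨h, h'⟩ | ⟨h, h'⟩ | ⟨h, h'⟩)
    · exact Or.inl ⟨h.symm, h'.symm⟩
    · exact Or.inr (Or.inl ⟨h.symm, h'.symm⟩)
    · exact Or.inr (Or.inr ⟨h.symm, h'.symm⟩)⟩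
  loopless := ⟨by
    rintro p (⟨-, h⟩ | ⟨h, -⟩ | ⟨h, -⟩)
    · exact H.irrefl h
    · exact G.irrefl h
    · exact G.irrefl h⟩

/-- The space-time graph `G ⊠ ℕ`, where consecutive integers are adjacent in `ℕ`. -/
def spaceTime : SimpleGraph (V × ℕ) := strongProduct G (SimpleGraph.hasse ℕ)

/-- The connected component containing `p` of the subgraph of `H` induced by the vertex set `S`;
it is empty if `p ∉ S`. -/
def cluster (H : SimpleGraph V) (S : Set V) (p : V) : Set V :=
  {q | ∃ (hp : p ∈ S) (hq : q ∈ S), (H.induce S).Reachable ⟨p, hp⟩ ⟨q, hq⟩}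

/-- The diameter of a set of vertices in the graph distance of `H`, with values in
`{-∞} ∪ ℕ ∪ {∞}`; the empty set has diameter `-∞`. -/
noncomputable def diam (H : SimpleGraph V) (A : Set V) : WithBot ℕ∞ :=
  ⨆ p ∈ A, ⨆ q ∈ A, ((H.edist p q : ℕ∞) : WithBot ℕ∞)

end Graph

/-- The two processes: the `j`-threshold Consensus Process and `j`-neighbour Bootstrap Percolation
with noise. -/
inductive Kind : Type
  | consensus
  | bootstrap

section Dynamics

variable {V : Type u} (G : SimpleGraph V) [G.LocallyFinite]

/-- The number of neighbours of `x` with value `1` in the configuration `η`. -/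
def onesAround (η : V → Fin 2) (x : V) : ℕ := ∑ y ∈ G.neighborFinset x, (η y : ℕ)

/-- The new value at an update point `x`, given the current configuration `η`. -/
def updateRule (j : ℕ) : Kind → (V → Fin 2) → V → Fin 2
  | .consensus, η, x => if j ≤ onesAround G η x then 1 else 0
  | .bootstrap, η, x => max (η x) (if j ≤ onesAround G η x then 1 else 0)

/-- The process with threshold `j` and `ε`-noise started from the all-ones configuration, as a
function of a realization `l` of the variables `L_x(t)`, `x ∈ V`, `t ≥ 1`. -/
noncomputable def process (Ξ : Kind) (j : ℕ) (ε : ℝ) (l : V × ℕ+ → ℝ) : ℕ → V → Fin 2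
  | 0 => fun _ => 1
  | t + 1 => fun x =>
      if l (x, t.succPNat) < ε then 0 else updateRule G j Ξ (process Ξ j ε l t) x

/-- The set of space-time zeros of the process. -/
def zeroSet (Ξ : Kind) (j : ℕ) (ε : ℝ) (l : V × ℕ+ → ℝ) : Set (V × ℕ) :=
  {p | process G Ξ j ε l p.2 p.1 = 0}

/-- The parameter `j` is good for the given process. -/
def Good (j : ℕ) : Kind → Prop
  | .bootstrap => (j : ℝ) < edgeExpansion G + 1 ∨ j ≤ jBar G
  | .consensus =>
      2 * (j : ℝ) < 3 * edgeExpansion G - (maxDeg G : ℝ) + 2 ∨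
      (G.IsBipartite ∧ (j : ℝ) < edgeExpansion G + 1) ∨
      (j : ℝ) < vertexExpansion G ∨
      (∃ d : ℕ, 2 ≤ d ∧ G.IsTree ∧ G.IsRegularOfDegree d ∧ j < d)

end Dynamics

/-- The family `L_x(t)`, `x ∈ V`, `t ≥ 1`, consists of independent random variables, each
uniformly distributed on `[0, 1]`. -/
structure IsUniformNoise {V : Type u} {Ω : Type v} [MeasurableSpace Ω] (P : Measure Ω)
    (L : V × ℕ+ → Ω → ℝ) : Prop where
  measurable : ∀ p, Measurable (L p)
  uniform : ∀ p, pdf.IsUniform (L p) (Set.Icc 0 1) P volume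
  indep : iIndepFun L P

end NoisyThreshold

/-! A zero without noise has fewer than `j` ones among its neighbours one time step earlier, hence
zeros to which it can be traced back. There are no zeros at time 0, so every such history ends in
noises. Goodness of `j` forces the history to spread, and spreading can only be stopped by many
noises: each zero lies in a finite set, linked by bounded steps, in which noises have density at
least `1 / C` (`Charged`).

Given this, the tail bound is a Peierls argument. A linked set is covered by a walk of twice its
size, so there are exponentially many candidates of size `n`, while the required noises cost a power
of `ε` proportional to `n` (`measure_charged_le`). A cluster of large diameter produces one large
charged set by gluing the sets of its points along a shortest chain (`exists_charged_of_joined`).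

Charged sets come from three mechanisms. Expansion: a weight on `V` grows strictly from a noiseless
generation to its zero neighbours one step earlier, so the noises must absorb the total weight
(`exists_charged_of_weight`). The weight is `deg - Φ_E` when `j < Φ_E + 1`, by submodularity of the
edge boundary, and constant when `j < Φ_V`. Toom cycles: for bootstrap with `j ≤ jBar`, a noiseless
zero has two ancestors, itself and a neighbour farther from a root, which move apart in a suitable
linear coordinate. A closed path of arcs follows both, and closedness balances the displacements
(`exists_charged_of_two_charges`). Trees: with threshold `d - 1` a noiseless vertex is zero exactly
when two neighbours were zero. Rows of zeros lengthen backwards in time, and splitting or shortening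
a row uses noises; acyclicity keeps the histories of separated pieces disjoint (`exists_rowCover`).
-/

namespace NoisyThreshold

open scoped Classical

universe w

/-! ### Linked sets and covering walks. -/

section Linked

variable {X : Type*} {R : X → X → Prop}

/-- `a` and `b` are joined by a sequence of `R`-steps between points of `B`. -/
def JoinedIn (R : X → X → Prop) (B : Set X) : X → X → Prop :=
  Relation.ReflTransGen fun u v => R u v ∧ u ∈ B ∧ v ∈ B

/-- Any two points of `B` are joined by `R`-steps inside `B`. -/
def Linked (R : X → X → Prop) (B : Set X) : Prop :=
  ∀ a ∈ B, ∀ b ∈ B, JoinedIn R B a b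

theorem JoinedIn.mono {A B : Set X} (h : A ⊆ B) {a b : X} (hab : JoinedIn R A a b) :
    JoinedIn R B a b := by
  induction hab with
  | refl => exact .refl
  | tail _ h' ih => exact ih.tail ⟨h'.1, h h'.2.1, h h'.2.2⟩

theorem JoinedIn.trans {B : Set X} {a b c : X} (hab : JoinedIn R B a b) (hbc : JoinedIn R B b c) :
    JoinedIn R B a c := Relation.ReflTransGen.trans hab hbc

theorem JoinedIn.symm (hR : ∀ a b, R a b → R b a) {B : Set X} {a b : X}
    (hab : JoinedIn R B a b) : JoinedIn R B b a := by
  induction hab with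
  | refl => exact .refl
  | tail _ h' ih => exact (Relation.ReflTransGen.single ⟨hR _ _ h'.1, h'.2.2, h'.2.1⟩).trans ih

theorem linked_of_center (hR : ∀ a b, R a b → R b a) {B : Set X} {p : X}
    (h : ∀ b ∈ B, JoinedIn R B p b) : Linked R B :=
  fun a ha b hb => ((h a ha).symm hR).trans (h b hb)

theorem linked_singleton (a : X) : Linked R {a} := by
  rintro x rfl y rfl
  exact .refl

theorem Linked.union (hR : ∀ a b, R a b → R b a) {A B : Set X} (hA : Linked R A)
    (hB : Linked R B) {c : X} (hcA : c ∈ A) (hcB : c ∈ B) : Linked R (A ∪ B) := by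
  refine linked_of_center hR (p := c) ?_
  rintro b (hb | hb)
  · exact (hA c hcA b hb).mono Set.subset_union_left
  · exact (hB c hcB b hb).mono Set.subset_union_right

theorem Linked.union_of_rel (hR : ∀ a b, R a b → R b a) {A B : Set X} (hA : Linked R A)
    (hB : Linked R B) {c d : X} (hcA : c ∈ A) (hdB : d ∈ B) (hcd : R c d) :
    Linked R (A ∪ B) := by
  refine linked_of_center hR (p := c) ?_
  rintro b (hb | hb)
  · exact (hA c hcA b hb).mono Set.subset_union_left
  · exact JoinedIn.trans (Relation.ReflTransGen.single ⟨hcd, Or.inl hcA, Or.inr hdB⟩)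
      ((hB d hdB b hb).mono Set.subset_union_right)

theorem Linked.insert_of_rel (hR : ∀ a b, R a b → R b a) {B : Set X} (hB : Linked R B) {c d : X}
    (hdB : d ∈ B) (hcd : R c d) : Linked R (insert c B) := by
  rw [Set.insert_eq]
  exact (linked_singleton c).union_of_rel hR hB rfl hdB hcd

theorem linked_pair (hR : ∀ a b, R a b → R b a) {a b : X} (h : R a b) : Linked R {a, b} :=
  (linked_singleton b).insert_of_rel hR rfl h

theorem JoinedIn.exists_exit {B : Set X} {S : Set X} {a b : X} (h : JoinedIn R B a b)
    (ha : a ∈ S) (hb : b ∉ S) : ∃ u ∈ S, ∃ v ∈ B, v ∉ S ∧ R u v := by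
  induction h with
  | refl => exact absurd ha hb
  | @tail c d _ h' ih =>
    by_cases hc : c ∈ S
    · exact ⟨c, hc, d, h'.2.2, hb, h'.1⟩
    · exact ih hc

/-- A linked set is covered by a walk from any of its points of length twice its size. -/
theorem Linked.exists_covering_walk (hR : ∀ a b, R a b → R b a) {B : Finset X}
    (hB : Linked R (B : Set X)) {p : X} (hp : p ∈ B) :
    ∃ l : List X, (p :: l).IsChain R ∧ (∀ q, q ∈ p :: l ↔ q ∈ B) ∧
      l.length = 2 * (B.card - 1) := by
  have key : ∀ k, 1 ≤ k → k ≤ B.card → ∃ l : List X, (p :: l).IsChain R ∧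
      (p :: l).toFinset ⊆ B ∧ (p :: l).toFinset.card = k ∧ l.length = 2 * (k - 1) := by
    intro k hk
    induction k, hk using Nat.le_induction with
    | base => exact fun _ => ⟨[], by simp, by simpa using hp, by simp, by simp⟩
    | succ k hk ih =>
      intro hkB
      obtain ⟨l, hl, hlB, hlk, hln⟩ := ih (by omega)
      obtain ⟨b, hbB, hb⟩ : ∃ b ∈ B, b ∉ (p :: l).toFinset := by
        by_contra! hcon
        have := Finset.card_le_card (show B ⊆ (p :: l).toFinset from hcon)
        omega
      obtain ⟨u, hu, v, hvB, hv, huv⟩ := (hB p hp b hbB).exists_exit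
        (S := ((p :: l).toFinset : Set X)) (by simp) (by simpa using hb)
      have hu' : u ∈ p :: l := by simpa using hu
      have hvp : v ∉ p :: l := by simpa using hv
      obtain ⟨l₁, l₂, hsp⟩ := List.mem_iff_append.1 hu'
      -- The walk makes a detour `u, v, u`: one new point costs two steps.
      have hchain : (l₁ ++ u :: v :: u :: l₂).IsChain R := by
        rw [hsp] at hl
        rw [List.isChain_append_cons_cons]
        rw [List.isChain_split] at hl
        refine ⟨hl.1, huv, ?_⟩
        rw [List.isChain_cons_cons]
        exact ⟨hR _ _ huv, hl.2⟩
      obtain ⟨m, hm⟩ : ∃ m, l₁ ++ u :: v :: u :: l₂ = p :: m := by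
        cases l₁ with
        | nil => simp only [List.nil_append, List.cons.injEq] at hsp ⊢; simp [hsp.1]
        | cons a l₁ => simp only [List.cons_append, List.cons.injEq] at hsp ⊢; simp [hsp.1]
      have hset : (p :: m).toFinset = insert v (p :: l).toFinset := by
        rw [← hm, hsp]
        ext z
        simp only [List.mem_toFinset, List.mem_append, List.mem_cons, Finset.mem_insert]
        tauto
      refine ⟨m, hm ▸ hchain, ?_, ?_, ?_⟩
      · rw [hset]
        exact Finset.insert_subset hvB hlB
      · rw [hset, Finset.card_insert_of_notMem (by simpa using hv), hlk]
      · have h1 := congrArg List.length hm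
        have h2 := congrArg List.length hsp
        simp only [List.length_append, List.length_cons] at h1 h2
        omega
  obtain ⟨l, h1, h2, h3, h4⟩ := key B.card (Finset.card_pos.2 ⟨p, hp⟩) le_rfl
  refine ⟨l, h1, fun q => ?_, h4⟩
  rw [← Finset.eq_of_subset_of_card_le h2 h3.ge, List.mem_toFinset]

end Linked

/-! ### The Peierls estimate. -/

section Peierls

variable {X : Type*}

/-- The walks with `n` steps starting from a given point. -/
noncomputable def walks (nb : X → Finset X) : ℕ → X → Finset (List X)
  | 0, p => {[p]}
  | n + 1, p => (nb p).biUnion fun q => (walks nb n q).image (List.cons p)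

theorem card_walks_le (nb : X → Finset X) {M : ℕ} (hM : ∀ x, (nb x).card ≤ M) (n : ℕ) (p : X) :
    (walks nb n p).card ≤ M ^ n := by
  induction n generalizing p with
  | zero => simp [walks]
  | succ n ih =>
    rw [walks, pow_succ']
    refine Finset.card_biUnion_le.trans ((Finset.sum_le_card_nsmul _ _ (M ^ n) ?_).trans ?_)
    · exact fun q _ => Finset.card_image_le.trans (ih q)
    · exact Nat.mul_le_mul_right _ (hM p)

theorem mem_walks (nb : X → Finset X) (l : List X) (p : X)
    (h : (p :: l).IsChain fun a b => b ∈ nb a) : p :: l ∈ walks nb l.length p := by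
  induction l generalizing p with
  | nil => simp [walks]
  | cons q l ih =>
    rw [List.isChain_cons_cons] at h
    simp only [List.length_cons, walks, Finset.mem_biUnion, Finset.mem_image]
    exact ⟨q, h.1, _, ih q h.2, rfl⟩

/-- `B` is linked and a fraction at least `1 / C` of its points belong to `D`. -/
def Charged (R : X → X → Prop) (D : Set X) (C : ℕ) (B : Finset X) : Prop :=
  Linked R (B : Set X) ∧ B.card ≤ C * (B.filter (· ∈ D)).card

/-- The Peierls estimate for linked sets with a positive density of points of a random set. -/
theorem measure_charged_le {Ω : Type*} [MeasurableSpace Ω] (μ : Measure Ω) (nb : X → Finset X)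
    (hsymm : ∀ a b, b ∈ nb a → a ∈ nb b) {M : ℕ} (hM1 : 1 ≤ M) (hM : ∀ x, (nb x).card ≤ M)
    (C : ℕ) (y : ENNReal) (hy : 4 * (M : ENNReal) ^ 2 * y ≤ 1) (D : Ω → Set X)
    (hD : ∀ S : Finset X, μ {w | (S : Set X) ⊆ D w} ≤ y ^ (2 * C * S.card)) (p : X) (n : ℕ) :
    μ {w | ∃ B : Finset X, p ∈ B ∧ Charged (fun a b => b ∈ nb a) (D w) C B ∧ n ≤ B.card} ≤
      y ^ n := by
  have hy1 : y ≤ 1 := by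
    refine le_trans ?_ hy
    have : (1 : ENNReal) ≤ 4 * (M : ENNReal) ^ 2 := by
      have : (1 : ENNReal) ≤ (M : ENNReal) := by exact_mod_cast hM1
      calc (1 : ENNReal) = 1 * 1 ^ 2 := by norm_num
        _ ≤ 4 * (M : ENNReal) ^ 2 := by gcongr; norm_num
    calc y = 1 * y := (one_mul y).symm
      _ ≤ _ := by gcongr
  -- A charged set is encoded by its size `N + 1`, a covering walk `l` with `2 * N` steps, and its
  -- subset `S` of noises.
  set Ev : ℕ → List X → Finset X → Set Ω := fun N l S =>
    {w | l.toFinset.card = N + 1 ∧ n ≤ N + 1 ∧ N + 1 ≤ C * S.card ∧ (S : Set X) ⊆ D w} with hEv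
  have hsub : {w | ∃ B : Finset X, p ∈ B ∧ Charged (fun a b => b ∈ nb a) (D w) C B ∧
      n ≤ B.card} ⊆ ⋃ N : ℕ, ⋃ l ∈ walks nb (2 * N) p, ⋃ S ∈ l.toFinset.powerset, Ev N l S := by
    rintro w ⟨B, hpB, ⟨hB, hBC⟩, hn⟩
    obtain ⟨l, hl1, hl2, hl3⟩ := hB.exists_covering_walk hsymm hpB
    replace hl2 : (p :: l).toFinset = B := by ext q; rw [List.mem_toFinset, hl2]
    have hpos : 0 < B.card := Finset.card_pos.2 ⟨p, hpB⟩
    simp only [Set.mem_iUnion, hEv]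
    refine ⟨B.card - 1, p :: l, ?_, B.filter (· ∈ D w), ?_, ?_, ?_, ?_, ?_⟩
    · rw [← hl3]; exact mem_walks nb l p hl1
    · rw [hl2]; simp
    · rw [hl2]; omega
    · omega
    · omega
    · intro x hx
      simp only [Finset.coe_filter, Set.mem_ofPred_eq] at hx
      exact hx.2
  have hbound : ∀ N : ℕ, ∀ l : List X, ∀ S : Finset X,
      μ (Ev N l S) ≤ if l.toFinset.card = N + 1 then y ^ (N + 1) * y ^ n else 0 := by
    intro N l S
    by_cases h1 : l.toFinset.card = N + 1
    swap
    · simp [hEv, h1]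
    rw [if_pos h1]
    by_cases h2 : n ≤ N + 1 ∧ N + 1 ≤ C * S.card
    swap
    · have : Ev N l S = ∅ := by
        ext w
        simp only [hEv, Set.mem_ofPred_eq, Set.mem_empty_iff_false, iff_false]
        tauto
      rw [this]; simp
    calc μ (Ev N l S) ≤ μ {w | (S : Set X) ⊆ D w} := measure_mono fun w hw => hw.2.2.2
      _ ≤ y ^ (2 * C * S.card) := hD S
      -- Both `N + 1` and `n` are at most `C * S.card`. Half of the exponent pays for the entropy,
      -- the other half leaves `y ^ n`.
      _ ≤ y ^ (N + 1 + n) := by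
        refine pow_le_pow_right_of_le_one' hy1 ?_
        nlinarith [h2.1, h2.2]
      _ = _ := pow_add _ _ _
  calc μ _ ≤ μ (⋃ N : ℕ, ⋃ l ∈ walks nb (2 * N) p, ⋃ S ∈ l.toFinset.powerset, Ev N l S) :=
        measure_mono hsub
    _ ≤ ∑' N : ℕ, μ (⋃ l ∈ walks nb (2 * N) p, ⋃ S ∈ l.toFinset.powerset, Ev N l S) :=
        measure_iUnion_le _
    _ ≤ ∑' N : ℕ, (2⁻¹ : ENNReal) ^ (N + 1) * y ^ n := by
        refine ENNReal.tsum_le_tsum fun N => ?_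
        have hl : ∀ l ∈ walks nb (2 * N) p,
            μ (⋃ S ∈ l.toFinset.powerset, Ev N l S) ≤ 2 ^ (N + 1) * (y ^ (N + 1) * y ^ n) := by
          intro l _
          refine (measure_biUnion_finset_le _ _).trans ?_
          refine (Finset.sum_le_sum fun S _ => hbound N l S).trans ?_
          rw [Finset.sum_const, Finset.card_powerset]
          split_ifs with h
          · rw [h, nsmul_eq_mul]; push_cast; exact le_rfl
          · simp
        calc μ (⋃ l ∈ walks nb (2 * N) p, ⋃ S ∈ l.toFinset.powerset, Ev N l S)
            ≤ ∑ l ∈ walks nb (2 * N) p, μ (⋃ S ∈ l.toFinset.powerset, Ev N l S) :=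
              measure_biUnion_finset_le _ _
          _ ≤ (walks nb (2 * N) p).card • (2 ^ (N + 1) * (y ^ (N + 1) * y ^ n)) :=
              Finset.sum_le_card_nsmul _ _ _ hl
          _ ≤ (M : ENNReal) ^ (2 * (N + 1)) * (2 ^ (N + 1) * (y ^ (N + 1) * y ^ n)) := by
              rw [nsmul_eq_mul]
              gcongr
              have : (walks nb (2 * N) p).card ≤ M ^ (2 * (N + 1)) :=
                (card_walks_le nb hM _ p).trans (Nat.pow_le_pow_right hM1 (by omega))
              exact_mod_cast this
          -- Walks and subsets together contribute the base `2 * M ^ 2 * y`, at most `1 / 2` by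
          -- `hy`, so the sum over `N` is at most `y ^ n`.
          _ = ((M : ENNReal) ^ 2 * 2 * y) ^ (N + 1) * y ^ n := by
              rw [mul_pow, mul_pow, ← pow_mul]; ring
          _ ≤ _ := by
              gcongr
              rw [← one_div, ENNReal.le_div_iff_mul_le (by simp) (by simp)]
              refine le_trans (le_of_eq ?_) hy
              ring
    _ = y ^ n := by
        rw [ENNReal.tsum_mul_right]
        have : ∑' N : ℕ, (2⁻¹ : ENNReal) ^ (N + 1) = 1 := by
          simp_rw [pow_succ]
          rw [ENNReal.tsum_mul_right, ENNReal.tsum_geometric, ENNReal.one_sub_inv_two, inv_inv]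
          exact ENNReal.mul_inv_cancel (by simp) (by simp)
        rw [this, one_mul]

end Peierls

/-! ### Gluing charged sets along a chain. -/

section Chain

variable {X : Type*} {R : X → X → Prop}

/-- A shortest sequence of `E`-steps has no `E`-steps between points that are not consecutive. -/
theorem exists_chordless_sequence {E : X → X → Prop} {p q : X} (h : Relation.ReflTransGen E p q) :
    ∃ (r : ℕ) (g : ℕ → X), g 0 = p ∧ g r = q ∧ (∀ i < r, E (g i) (g (i + 1))) ∧
      ∀ i j, i + 2 ≤ j → j ≤ r → ¬ E (g i) (g j) := by
  have hex : ∃ r : ℕ, ∃ g : ℕ → X, g 0 = p ∧ g r = q ∧ ∀ i < r, E (g i) (g (i + 1)) := by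
    induction h with
    | refl => exact ⟨0, fun _ => p, rfl, rfl, by simp⟩
    | @tail a b _ hab ih =>
      obtain ⟨r, g, h0, hr, hg⟩ := ih
      refine ⟨r + 1, fun i => if i ≤ r then g i else b, by simp [h0], by simp, fun i hi => ?_⟩
      rcases Nat.lt_succ_iff_lt_or_eq.1 hi with h | rfl
      · simpa [h.le, Nat.succ_le_of_lt h] using hg i h
      · simpa [hr] using hab
  obtain ⟨g, h0, hr, hg⟩ := Nat.find_spec hex
  set r := Nat.find hex with hrdef
  refine ⟨r, g, h0, hr, hg, fun i j hij hj hE => ?_⟩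
  refine Nat.find_min hex (m := r - (j - i - 1)) (by omega)
    ⟨fun k => if k ≤ i then g k else g (k + (j - i - 1)), by simp [h0], ?_, fun k hk => ?_⟩ <;> beta_reduce
  · rw [if_neg (by omega), ← hr]
    congr 1; omega
  · rcases lt_trichotomy k i with h | rfl | h
    · simpa [h.le, Nat.succ_le_of_lt h] using hg k (by omega)
    · rw [if_pos le_rfl, if_neg (by omega)]
      convert hE using 2; omega
    · rw [if_neg (by omega), if_neg (by omega)]
      have := hg (k + (j - i - 1)) (by omega)
      convert this using 2; omega

theorem linked_biUnion_range (hR : ∀ a b, R a b → R b a) (r : ℕ) (T : ℕ → Finset X)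
    (hT : ∀ i ≤ r, Linked R (T i : Set X)) (hn : ∀ i < r, ∃ c, c ∈ T i ∧ c ∈ T (i + 1)) :
    Linked R ((Finset.range (r + 1)).biUnion T : Set X) := by
  induction r with
  | zero => simpa using hT 0 le_rfl
  | succ r ih =>
    obtain ⟨c, hc, hc'⟩ := hn r (by omega)
    have := (ih (fun i hi => hT i (by omega)) (fun i hi => hn i (by omega))).union hR
      (hT (r + 1) le_rfl) (c := c)
      (by simp only [Finset.coe_biUnion, Set.mem_iUnion]; exact ⟨r, by simp, hc⟩) hc'
    rw [Finset.range_add_one, Finset.biUnion_insert, Finset.coe_union, Set.union_comm]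
    exact this

/-- If each point of `Z` lies in a charged set, then so does each pair of points
that are joined in `Z`. -/
theorem exists_charged_of_joined (hR : ∀ a b, R a b → R b a) {Z D : Set X} {C : ℕ}
    (hZ : ∀ z ∈ Z, ∃ B, z ∈ B ∧ Charged R D C B) {p q : X} (hp : p ∈ Z)
    (hpq : JoinedIn R Z p q) : ∃ B, p ∈ B ∧ q ∈ B ∧ Charged R D (6 * C) B := by
  choose! b hbz hbC using hZ
  -- `E` contains the `R`-steps in `Z` and also all pairs whose sets `b u`, `b v` meet. Along a
  -- shortest `E`-chain the sets of nonconsecutive points are therefore disjoint.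
  set E : X → X → Prop := fun u v => u ∈ Z ∧ v ∈ Z ∧ ∃ S : Finset X, u ∈ S ∧ v ∈ S ∧
    Linked R (S : Set X) ∧ S.card ≤ (b u).card + (b v).card with hE
  have hpqE : Relation.ReflTransGen E p q := by
    refine Relation.ReflTransGen.mono (fun u v => ?_) _ _ hpq
    rintro ⟨h, hu, hv⟩
    refine ⟨hu, hv, {u, v}, by simp, by simp, by simpa using linked_pair hR h, ?_⟩
    have h1 : 0 < (b u).card := Finset.card_pos.2 ⟨u, hbz u hu⟩
    have h2 : 0 < (b v).card := Finset.card_pos.2 ⟨v, hbz v hv⟩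
    exact Finset.card_le_two.trans (by omega)
  obtain ⟨r, g, h0, hr, hg, hch⟩ := exists_chordless_sequence hpqE
  have hgZ : ∀ i ≤ r, g i ∈ Z := by
    intro i hi
    rcases Nat.eq_zero_or_pos i with rfl | hi0
    · rwa [h0]
    · have := (hg (i - 1) (by omega)).2.1
      rwa [Nat.sub_add_cancel hi0] at this
  have hS : ∀ i < r, ∃ S : Finset X, g i ∈ S ∧ g (i + 1) ∈ S ∧
    Linked R (S : Set X) ∧ S.card ≤ (b (g i)).card + (b (g (i + 1))).card :=
    fun i hi => (hg i hi).2.2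
  choose! S hS1 hS2 hS3 hS4 using hS
  have hdisj : ∀ i j, i + 2 ≤ j → j ≤ r → Disjoint (b (g i)) (b (g j)) := by
    intro i j hij hj
    rw [Finset.disjoint_left]
    intro c hci hcj
    have hi' := hgZ i (by omega)
    have hj' := hgZ j hj
    refine hch i j hij hj ⟨hi', hj', b (g i) ∪ b (g j), ?_, ?_, ?_, Finset.card_union_le _ _⟩
    · exact Finset.mem_union_left _ (hbz _ hi')
    · exact Finset.mem_union_right _ (hbz _ hj')
    · rw [Finset.coe_union]
      exact (hbC _ hi').1.union hR (hbC _ hj').1 hci hcj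
  set T : ℕ → Finset X := fun i => if i < r then b (g i) ∪ S i else b (g i) with hT
  have hbT : ∀ i, b (g i) ⊆ T i := by
    intro i
    simp only [hT]
    split_ifs
    · exact Finset.subset_union_left
    · exact subset_rfl
  have hTl : ∀ i ≤ r, Linked R (T i : Set X) := by
    intro i hi
    simp only [hT]
    split_ifs with h
    · rw [Finset.coe_union]
      exact (hbC _ (hgZ i hi)).1.union hR (hS3 i h) (hbz _ (hgZ i hi)) (hS1 i h)
    · exact (hbC _ (hgZ i hi)).1
  set B := (Finset.range (r + 1)).biUnion T with hB
  -- Indices of equal parity give disjoint sets, whose noises are counted once; the two parities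
  -- cost a factor 2.
  have hnoise : ∀ e : ℕ, ∑ i ∈ (Finset.range (r + 1)).filter (fun i => i % 2 = e),
      ((b (g i)).filter (· ∈ D)).card ≤ (B.filter (· ∈ D)).card := by
    intro e
    rw [← Finset.card_biUnion]
    · refine Finset.card_le_card fun x hx => ?_
      simp only [Finset.mem_biUnion, Finset.mem_filter] at hx ⊢
      obtain ⟨i, ⟨hi, -⟩, hx, hxD⟩ := hx
      exact ⟨Finset.mem_biUnion.2 ⟨i, hi, hbT i hx⟩, hxD⟩
    · intro i hi j hj hij
      simp only [Finset.coe_filter, Finset.mem_range, Set.mem_ofPred_eq] at hi hj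
      refine Finset.disjoint_filter_filter ?_
      rcases lt_or_gt_of_ne hij with h | h
      · exact hdisj i j (by omega) (by omega)
      · exact (hdisj j i (by omega) (by omega)).symm
  have hsum : ∑ i ∈ Finset.range (r + 1), ((b (g i)).filter (· ∈ D)).card ≤
      2 * (B.filter (· ∈ D)).card := by
    rw [← Finset.sum_filter_add_sum_filter_not _ (fun i => i % 2 = 0)]
    have h1 := hnoise 0
    have h2 := hnoise 1
    have h3 : (Finset.range (r + 1)).filter (fun i => ¬ i % 2 = 0) =
        (Finset.range (r + 1)).filter (fun i => i % 2 = 1) := by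
      ext i; simp
    rw [h3]
    omega
  -- Each `b (g i)` is charged once for itself and once for each of the at most two connecting sets
  -- at `g i`. With the parity factor this gives `6 * C`.
  have hsize : B.card ≤ 3 * ∑ i ∈ Finset.range (r + 1), (b (g i)).card := by
    calc B.card ≤ ∑ i ∈ Finset.range (r + 1), (T i).card := Finset.card_biUnion_le
      _ = ∑ i ∈ Finset.range r, (T i).card + (b (g r)).card := by
          rw [Finset.sum_range_succ]; simp [hT]
      _ ≤ ∑ i ∈ Finset.range r, (2 * (b (g i)).card + (b (g (i + 1))).card) + (b (g r)).card := by
          gcongr with i hi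
          have hi' := Finset.mem_range.1 hi
          simp only [hT, if_pos hi']
          have := hS4 i hi'
          have := Finset.card_union_le (b (g i)) (S i)
          omega
      _ ≤ _ := by
          rw [Finset.sum_add_distrib, ← Finset.mul_sum]
          have h1 := Finset.sum_range_succ (fun i => (b (g i)).card) r
          have h2 := Finset.sum_range_succ' (fun i => (b (g i)).card) r
          omega
  refine ⟨B, ?_, ?_, ?_, ?_⟩
  · exact Finset.mem_biUnion.2 ⟨0, by simp, hbT 0 (by rw [h0]; exact hbz p hp)⟩
  · refine Finset.mem_biUnion.2 ⟨r, by simp, hbT r ?_⟩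
    have := hbz _ (hgZ r le_rfl)
    rwa [hr] at this ⊢
  · refine linked_biUnion_range hR r T hTl fun i hi => ⟨g (i + 1), ?_, ?_⟩
    · simp only [hT, if_pos hi]
      exact Finset.mem_union_right _ (hS2 i hi)
    · exact hbT _ (hbz _ (hgZ _ (by omega)))
  · have h1 : ∑ i ∈ Finset.range (r + 1), (b (g i)).card ≤
        C * ∑ i ∈ Finset.range (r + 1), ((b (g i)).filter (· ∈ D)).card := by
      rw [Finset.mul_sum]
      exact Finset.sum_le_sum fun i hi => (hbC _ (hgZ i (by simpa [Nat.lt_succ_iff] using hi))).2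
    calc B.card ≤ 3 * (C * (2 * (B.filter (· ∈ D)).card)) :=
          hsize.trans (Nat.mul_le_mul_left _ (h1.trans (Nat.mul_le_mul_left _ hsum)))
      _ = _ := by ring

end Chain

/-! ### Noises, zeros and the local rule. -/

section Zeros

variable {V : Type*} (G : SimpleGraph V) [G.LocallyFinite]

/-- The set of space-time points at which a noise occurs. -/
def noiseSet (ε : ℝ) (l : V × ℕ+ → ℝ) : Set (V × ℕ) :=
  {p | ∃ s : ℕ, p.2 = s + 1 ∧ l (p.1, s.succPNat) < ε}

/-- The neighbours of `x` at which the set `A` of space-time points is present at time `s`. -/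
noncomputable def nbrsIn (A : Set (V × ℕ)) (x : V) (s : ℕ) : Finset V :=
  (G.neighborFinset x).filter fun y => (y, s) ∈ A

variable {G}

theorem mem_nbrsIn {A : Set (V × ℕ)} {x y : V} {s : ℕ} :
    y ∈ nbrsIn G A x s ↔ G.Adj x y ∧ (y, s) ∈ A := by
  simp [nbrsIn]

theorem mem_noiseSet_succ {ε : ℝ} {l : V × ℕ+ → ℝ} {x : V} {s : ℕ} :
    (x, s + 1) ∈ noiseSet ε l ↔ l (x, s.succPNat) < ε := by
  constructor
  · rintro ⟨s', h, h'⟩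
    obtain rfl : s = s' := by simpa using h
    exact h'
  · exact fun h => ⟨s, rfl, h⟩

theorem zero_notMem_zeroSet (Ξ : Kind) (j : ℕ) (ε : ℝ) (l : V × ℕ+ → ℝ) (x : V) :
    (x, 0) ∉ zeroSet G Ξ j ε l := by
  simp [zeroSet, process]

theorem onesAround_eq (Ξ : Kind) (j : ℕ) (ε : ℝ) (l : V × ℕ+ → ℝ) (x : V) (s : ℕ) :
    onesAround G (process G Ξ j ε l s) x = (nbrsIn G (zeroSet G Ξ j ε l)ᶜ x s).card := by
  rw [nbrsIn, Finset.card_filter, onesAround]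
  refine Finset.sum_congr rfl fun y _ => ?_
  simp only [zeroSet, Set.mem_compl_iff, Set.mem_ofPred_eq]
  generalize process G Ξ j ε l s y = v
  fin_cases v <;> simp

/-- The expansion arguments use no other property of the dynamics beyond the absence of zeros at
time 0, so they serve both processes. -/
theorem card_ones_lt {Ξ : Kind} {j : ℕ} {ε : ℝ} {l : V × ℕ+ → ℝ} {x : V} {s : ℕ}
    (hz : (x, s + 1) ∈ zeroSet G Ξ j ε l) (hn : (x, s + 1) ∉ noiseSet ε l) :
    (nbrsIn G (zeroSet G Ξ j ε l)ᶜ x s).card < j := by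
  rw [mem_noiseSet_succ] at hn
  rw [← onesAround_eq]
  simp only [zeroSet, Set.mem_ofPred_eq, process, if_neg hn] at hz
  by_contra! hj
  cases Ξ with
  | consensus => simp [updateRule, hj] at hz
  | bootstrap =>
    simp only [updateRule, if_pos hj] at hz
    have := le_max_right (process G .bootstrap j ε l s x) 1
    rw [hz] at this
    exact absurd this (by decide)

theorem zero_of_bootstrap {j : ℕ} {ε : ℝ} {l : V × ℕ+ → ℝ} {x : V} {s : ℕ}
    (hz : (x, s + 1) ∈ zeroSet G .bootstrap j ε l) (hn : (x, s + 1) ∉ noiseSet ε l) :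
    (x, s) ∈ zeroSet G .bootstrap j ε l := by
  rw [mem_noiseSet_succ] at hn
  simp only [zeroSet, Set.mem_ofPred_eq, process, if_neg hn, updateRule] at hz ⊢
  have := le_max_left (process G .bootstrap j ε l s x)
    (if j ≤ onesAround G (process G .bootstrap j ε l s) x then 1 else 0)
  rw [hz] at this
  exact le_antisymm this (Fin.zero_le _)

theorem mem_zeroSet_consensus_succ {j : ℕ} {ε : ℝ} {l : V × ℕ+ → ℝ} {x : V} {s : ℕ} :
    (x, s + 1) ∈ zeroSet G .consensus j ε l ↔ (x, s + 1) ∈ noiseSet ε l ∨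
      (nbrsIn G (zeroSet G .consensus j ε l)ᶜ x s).card < j := by
  rw [mem_noiseSet_succ, ← onesAround_eq]
  simp only [zeroSet, Set.mem_ofPred_eq, process, updateRule]
  split_ifs with h1 h2 <;> simp_all

/-- The rule is attractive. This lets the tree case assume the largest admissible threshold `d - 1`.
-/
theorem zeroSet_consensus_mono {i j : ℕ} (hij : i ≤ j) (ε : ℝ) (l : V × ℕ+ → ℝ) :
    zeroSet G .consensus i ε l ⊆ zeroSet G .consensus j ε l := by
  rintro ⟨x, t⟩
  induction t generalizing x with
  | zero => exact fun h => absurd h (zero_notMem_zeroSet _ _ _ _ _)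
  | succ s ih =>
    rw [mem_zeroSet_consensus_succ, mem_zeroSet_consensus_succ]
    rintro (h | h)
    · exact Or.inl h
    · refine Or.inr (lt_of_le_of_lt (Finset.card_le_card fun y hy => ?_) (h.trans_le hij))
      rw [mem_nbrsIn] at hy ⊢
      exact ⟨hy.1, fun hy' => hy.2 (ih y hy')⟩

end Zeros

/-! ### Backward exploration with a growing weight. -/

section Weight

variable {V : Type*} {G : SimpleGraph V} [G.LocallyFinite]

/-- If a weight grows by a positive amount per point from a finite set of noiseless points of `Z`
to the set of their neighbours in `Z` one time step before, then the points of `Z` are contained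
in charged sets. -/
theorem exists_charged_of_weight {R : V × ℕ → V × ℕ → Prop} (hR : ∀ a b, R a b → R b a)
    (hRG : ∀ x y s, G.Adj x y → R (x, s + 1) (y, s)) {Z D : Set (V × ℕ)}
    (hZ0 : ∀ x, (x, 0) ∉ Z) (w : V → ℝ) {W κ : ℝ} (hw0 : ∀ x, 0 ≤ w x) (hwW : ∀ x, w x ≤ W)
    (hκ : 0 < κ)
    (hgrow : ∀ (s : ℕ) (K : Finset V), (∀ x ∈ K, (x, s + 1) ∈ Z ∧ (x, s + 1) ∉ D) →
      ∑ x ∈ K, w x + κ * K.card ≤ ∑ y ∈ K.biUnion (nbrsIn G Z · s), w y)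
    {C : ℕ} (hC : W / κ + 1 ≤ C) : ∀ p ∈ Z, ∃ B, p ∈ B ∧ Charged R D C B := by
  -- `B` is the history of `A`: noises stop, other points are replaced by all their neighbours in
  -- `Z` one step earlier. Each noiseless point gains weight `κ`, each noise removes at most `W`,
  -- and nothing remains at time 0; the last clause is this balance.
  have key : ∀ (s : ℕ) (A : Finset V), (∀ x ∈ A, (x, s) ∈ Z) → ∃ B : Finset (V × ℕ),
      (∀ x ∈ A, (x, s) ∈ B) ∧ (∀ b ∈ B, b.2 ≤ s) ∧
      (∀ b ∈ B, ∃ x ∈ A, JoinedIn R (B : Set (V × ℕ)) (x, s) b) ∧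
      κ * (B.filter (· ∉ D)).card + ∑ x ∈ A, w x ≤ W * (B.filter (· ∈ D)).card := by
    intro s
    induction s with
    | zero =>
      intro A hA
      obtain rfl : A = ∅ := Finset.eq_empty_of_forall_notMem fun x hx => hZ0 x (hA x hx)
      exact ⟨∅, by simp⟩
    | succ s ih =>
      intro A hA
      set K := A.filter fun x => (x, s + 1) ∉ D with hK
      set N := A.filter fun x => (x, s + 1) ∈ D with hN
      obtain ⟨B, hB1, hB2, hB3, hB4⟩ := ih (K.biUnion (nbrsIn G Z · s)) (by
        intro y hy
        obtain ⟨x, -, hy⟩ := Finset.mem_biUnion.1 hy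
        exact (mem_nbrsIn.1 hy).2)
      have hg := hgrow s K (by
        intro x hx
        rw [hK, Finset.mem_filter] at hx
        exact ⟨hA x hx.1, hx.2⟩)
      set A' : Finset (V × ℕ) := A.image fun x => (x, s + 1) with hA'
      have hcard : ∀ T : Finset V, (T.image fun x => (x, s + 1)).card = T.card := fun T =>
        Finset.card_image_of_injective _ fun a b h => (Prod.ext_iff.1 h).1
      have hdisj : Disjoint B A' := by
        rw [Finset.disjoint_left]
        intro b hb hb'
        obtain ⟨x, -, rfl⟩ := Finset.mem_image.1 hb'
        have := hB2 _ hb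
        simp at this
      have hsplit : ∀ (q : V × ℕ → Prop) [DecidablePred q], ((B ∪ A').filter q).card =
          (B.filter q).card + (A.filter fun x => q (x, s + 1)).card := by
        intro q _
        rw [Finset.filter_union, Finset.card_union_of_disjoint
          (Finset.disjoint_filter_filter hdisj), hA', Finset.filter_image, hcard]
      refine ⟨B ∪ A', ?_, ?_, ?_, ?_⟩
      · exact fun x hx => Finset.mem_union_right _ (Finset.mem_image_of_mem _ hx)
      · intro b hb
        rcases Finset.mem_union.1 hb with hb | hb
        · exact (hB2 b hb).trans (Nat.le_succ s)
        · obtain ⟨x, -, rfl⟩ := Finset.mem_image.1 hb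
          exact le_rfl
      · intro b hb
        rcases Finset.mem_union.1 hb with hb | hb
        · obtain ⟨y, hy, hyb⟩ := hB3 b hb
          obtain ⟨x, hx, hxy⟩ := Finset.mem_biUnion.1 hy
          have hxA := (Finset.mem_filter.1 hx).1
          refine ⟨x, hxA, JoinedIn.trans (Relation.ReflTransGen.single
            ⟨hRG x y s (mem_nbrsIn.1 hxy).1, ?_, ?_⟩) (hyb.mono ?_)⟩
          · exact Finset.mem_union_right _ (Finset.mem_image_of_mem _ hxA)
          · exact Finset.mem_union_left _ (hB1 y hy)
          · rw [Finset.coe_union]; exact Set.subset_union_left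
        · obtain ⟨x, hx, rfl⟩ := Finset.mem_image.1 hb
          exact ⟨x, hx, .refl⟩
      · rw [hsplit, hsplit, ← Finset.sum_filter_add_sum_filter_not A (fun x => (x, s + 1) ∈ D)]
        have hNW : ∑ x ∈ N, w x ≤ W * N.card := by
          refine (Finset.sum_le_card_nsmul _ _ W fun x _ => hwW x).trans ?_
          rw [nsmul_eq_mul, mul_comm]
        push_cast
        rw [← hK, ← hN]
        linarith
  rintro ⟨x, s⟩ hp
  obtain ⟨B, hB1, -, hB3, hB4⟩ := key s {x} (by simpa using hp)
  refine ⟨B, hB1 x (by simp), linked_of_center hR (p := (x, s)) ?_, ?_⟩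
  · intro b hb
    obtain ⟨y, hy, h⟩ := hB3 b hb
    rwa [Finset.mem_singleton.1 hy] at h
  · have h1 := Finset.card_filter_add_card_filter_not (s := B) (fun b => b ∈ D)
    have h2 : κ * ((B.filter (· ∉ D)).card : ℝ) ≤ W * (B.filter (· ∈ D)).card := by
      have := hw0 x
      simp only [Finset.sum_singleton] at hB4
      linarith
    have h3 : ((B.filter (· ∉ D)).card : ℝ) ≤ W / κ * (B.filter (· ∈ D)).card := by
      rw [div_mul_eq_mul_div, le_div_iff₀ hκ]
      linarith
    have h4 : (B.card : ℝ) ≤ C * (B.filter (· ∈ D)).card := by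
      rw [← h1]
      push_cast
      have : (W / κ + 1) * ((B.filter (· ∈ D)).card : ℝ) ≤ C * (B.filter (· ∈ D)).card := by
        gcongr
      linarith
    exact_mod_cast h4

end Weight

/-! ### Isoperimetric inequalities as growth of a weight. -/

section Expansion

variable {V : Type*} {G : SimpleGraph V} [G.LocallyFinite]

theorem edgeExpansion_nonneg {V : Type*} {G : SimpleGraph V} : 0 ≤ edgeExpansion G :=
  Real.iInf_nonneg fun _ => by positivity

theorem edgeExpansion_mul_card_le (K : Finset V) :
    edgeExpansion G * K.card ≤ ∑ x ∈ K, ((G.neighborFinset x \ K).card : ℝ) := by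
  rcases K.eq_empty_or_nonempty with rfl | hK
  · simp
  have h1 : edgeExpansion G ≤ ((edgeBdry G (K : Set V)).ncard : ℝ) / (K.card : ℝ) :=
    ciInf_le ⟨0, by rintro _ ⟨_, rfl⟩; positivity⟩ (⟨K, hK⟩ : {K : Finset V // K.Nonempty})
  have hpos : (0 : ℝ) < K.card := by exact_mod_cast hK.card_pos
  rw [le_div_iff₀ hpos] at h1
  refine h1.trans ?_
  have h2 : edgeBdry G (K : Set V) ⊆
      (K.biUnion fun x => (G.neighborFinset x \ K).image fun y => s(x, y) : Finset (Sym2 V)) := by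
    rintro e ⟨x, hx, y, hy, hxy, rfl⟩
    simp only [Finset.coe_biUnion, Set.mem_iUnion, Finset.coe_image]
    exact ⟨x, hx, y, by simpa [hxy] using hy, rfl⟩
  have h3 : (edgeBdry G (K : Set V)).ncard ≤ ∑ x ∈ K, (G.neighborFinset x \ K).card := by
    refine (Set.ncard_le_ncard h2 (Finset.finite_toSet _)).trans ?_
    rw [Set.ncard_coe_finset]
    exact Finset.card_biUnion_le.trans (Finset.sum_le_sum fun x _ => Finset.card_image_le)
  exact_mod_cast h3

theorem edgeExpansion_le_degree (x : V) : edgeExpansion G ≤ G.degree x := by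
  have := edgeExpansion_mul_card_le (G := G) {x}
  simp only [Finset.card_singleton, Nat.cast_one, mul_one, Finset.sum_singleton] at this
  refine this.trans ?_
  rw [← G.card_neighborFinset_eq_degree]
  exact_mod_cast Finset.card_le_card Finset.sdiff_subset

theorem vertexExpansion_mul_card_le (K : Finset V) :
    vertexExpansion G * K.card ≤ ((K.biUnion (G.neighborFinset ·) \ K).card : ℝ) := by
  rcases K.eq_empty_or_nonempty with rfl | hK
  · simp
  have h1 : vertexExpansion G ≤ ((vertexBdry G (K : Set V)).ncard : ℝ) / (K.card : ℝ) :=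
    ciInf_le ⟨0, by rintro _ ⟨_, rfl⟩; positivity⟩ (⟨K, hK⟩ : {K : Finset V // K.Nonempty})
  have hpos : (0 : ℝ) < K.card := by exact_mod_cast hK.card_pos
  rw [le_div_iff₀ hpos] at h1
  refine h1.trans ?_
  have h2 : vertexBdry G (K : Set V) ⊆ (K.biUnion (G.neighborFinset ·) \ K : Finset V) := by
    rintro y ⟨hy, x, hx, hxy⟩
    simp only [Finset.coe_sdiff, Finset.coe_biUnion, Set.mem_sdiff, Set.mem_iUnion]
    exact ⟨⟨x, hx, by simpa using hxy.symm⟩, hy⟩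
  exact_mod_cast (Set.ncard_le_ncard h2 (Finset.finite_toSet _)).trans
    (Set.ncard_coe_finset _).le

/-- Submodularity, checked point by point. On `K ∩ P` it is an equality, because `N x \ K` and `N x
\ P` have union `N x \ (K ∩ P)` and intersection `N x \ (K ∪ P)`. -/
theorem sum_card_sdiff_le (N : V → Finset V) (K P : Finset V) :
    ∑ x ∈ K ∪ P, (N x \ (K ∪ P)).card + ∑ x ∈ K ∩ P, (N x \ (K ∩ P)).card ≤
      ∑ x ∈ K, (N x \ P).card + ∑ x ∈ P, (N x \ K).card := by
  have hu : ∀ f : V → ℕ, ∑ x ∈ K ∪ P, f x =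
      ∑ x ∈ K \ P, f x + ∑ x ∈ P \ K, f x + ∑ x ∈ K ∩ P, f x := by
    intro f
    rw [← Finset.sum_union, ← Finset.sum_union]
    · congr 1
      ext; simp; tauto
    · rw [Finset.disjoint_left]; intro a; simp; tauto
    · rw [Finset.disjoint_left]; intro a; simp; tauto
  have h1 : ∀ f : V → ℕ, ∑ x ∈ K, f x = ∑ x ∈ K \ P, f x + ∑ x ∈ K ∩ P, f x := by
    intro f
    rw [add_comm, Finset.sum_inter_add_sum_sdiff]
  have h2 : ∀ f : V → ℕ, ∑ x ∈ P, f x = ∑ x ∈ P \ K, f x + ∑ x ∈ K ∩ P, f x := by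
    intro f
    rw [add_comm, Finset.inter_comm, Finset.sum_inter_add_sum_sdiff]
  rw [hu, h1, h2]
  have h3 : ∑ x ∈ K \ P, (N x \ (K ∪ P)).card ≤ ∑ x ∈ K \ P, (N x \ P).card :=
    Finset.sum_le_sum fun x _ => Finset.card_le_card
      (Finset.sdiff_subset_sdiff subset_rfl Finset.subset_union_right)
  have h4 : ∑ x ∈ P \ K, (N x \ (K ∪ P)).card ≤ ∑ x ∈ P \ K, (N x \ K).card :=
    Finset.sum_le_sum fun x _ => Finset.card_le_card
      (Finset.sdiff_subset_sdiff subset_rfl Finset.subset_union_left)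
  have h5 : ∑ x ∈ K ∩ P, (N x \ (K ∪ P)).card + ∑ x ∈ K ∩ P, (N x \ (K ∩ P)).card =
      ∑ x ∈ K ∩ P, (N x \ P).card + ∑ x ∈ K ∩ P, (N x \ K).card := by
    rw [← Finset.sum_add_distrib, ← Finset.sum_add_distrib]
    refine Finset.sum_congr rfl fun x _ => ?_
    have := Finset.card_union_add_card_inter (N x \ K) (N x \ P)
    rw [show N x \ K ∪ N x \ P = N x \ (K ∩ P) by ext; simp; tauto,
      ← Finset.sdiff_union_distrib] at this
    omega
  omega

theorem sum_card_neighbor_inter_comm (K P : Finset V) :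
    ∑ x ∈ K, (G.neighborFinset x ∩ P).card = ∑ y ∈ P, (G.neighborFinset y ∩ K).card := by
  have := Finset.sum_card_bipartiteAbove_eq_sum_card_bipartiteBelow (s := K) (t := P) G.Adj
  convert this using 3 with x _ x _
  · ext; simp [Finset.bipartiteAbove, and_comm]
  · ext; simp [Finset.bipartiteBelow, and_comm, G.adj_comm]

/-- Edge expansion of `K ∪ P` and `K ∩ P`, uncrossed, bounds `Φ_E (|K| + |P|)` by the number of
edges from `K` out of `P` plus those from `P` out of `K`. Double counting the edges between `K` and
`P` turns the second number into the first plus the difference of the degree sums; the first is at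
most `(j - 1) |K|`. -/
theorem degree_weight_growth {j : ℕ} {K P : Finset V}
    (h : ∀ x ∈ K, (G.neighborFinset x \ P).card < j) :
    ∑ x ∈ K, ((G.degree x : ℝ) - edgeExpansion G) + 2 * (edgeExpansion G + 1 - j) * K.card ≤
      ∑ x ∈ P, ((G.degree x : ℝ) - edgeExpansion G) := by
  have hdeg : ∀ A B : Finset V, ∑ x ∈ A, G.degree x =
      ∑ x ∈ A, (G.neighborFinset x ∩ B).card + ∑ x ∈ A, (G.neighborFinset x \ B).card := by
    intro A B
    rw [← Finset.sum_add_distrib]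
    exact Finset.sum_congr rfl fun x _ => by
      rw [Finset.card_inter_add_card_sdiff, G.card_neighborFinset_eq_degree]
  have h1 : ∑ x ∈ K, (G.neighborFinset x \ P).card + K.card ≤ j * K.card := by
    rw [Finset.card_eq_sum_ones, ← Finset.sum_add_distrib, Finset.mul_sum]
    refine Finset.sum_le_sum fun x hx => ?_
    have := h x hx
    omega
  have h2 := sum_card_sdiff_le (G.neighborFinset ·) K P
  have h3 := edgeExpansion_mul_card_le (G := G) (K ∪ P)
  have h4 := edgeExpansion_mul_card_le (G := G) (K ∩ P)
  have h5 := Finset.card_union_add_card_inter K P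
  have h6 := sum_card_neighbor_inter_comm (G := G) K P
  have h7 := hdeg K P
  have h8 := hdeg P K
  rify at h1 h2 h5 h6 h7 h8
  rw [Finset.sum_sub_distrib, Finset.sum_sub_distrib, Finset.sum_const, Finset.sum_const,
    nsmul_eq_mul, nsmul_eq_mul]
  have h9 : edgeExpansion G * ((K ∪ P).card : ℝ) + edgeExpansion G * ((K ∩ P).card : ℝ) =
      edgeExpansion G * K.card + edgeExpansion G * P.card := by
    rw [← mul_add, h5, mul_add]
  nlinarith

theorem neighborFinset_sdiff_subset {Z : Set (V × ℕ)} {s : ℕ} {K : Finset V} {x : V}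
    (hx : x ∈ K) :
    G.neighborFinset x \ K.biUnion (nbrsIn G Z · s) ⊆ nbrsIn G Zᶜ x s := by
  intro y hy
  simp only [Finset.mem_sdiff, SimpleGraph.mem_neighborFinset, Finset.mem_biUnion, mem_nbrsIn,
    not_exists, not_and] at hy
  exact mem_nbrsIn.2 ⟨hy.1, hy.2 x hx hy.1⟩

theorem exists_charged_of_edgeExpansion {R : V × ℕ → V × ℕ → Prop} (hR : ∀ a b, R a b → R b a)
    (hRG : ∀ x y s, G.Adj x y → R (x, s + 1) (y, s)) {M : ℕ} (hM : ∀ x, G.degree x ≤ M) {j : ℕ}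
    (hj : (j : ℝ) < edgeExpansion G + 1) :
    ∃ C : ℕ, ∀ Z D : Set (V × ℕ), (∀ x, (x, 0) ∉ Z) →
      (∀ x s, (x, s + 1) ∈ Z → (x, s + 1) ∉ D → (nbrsIn G Zᶜ x s).card < j) →
      ∀ p ∈ Z, ∃ B, p ∈ B ∧ Charged R D C B := by
  obtain ⟨C, hC⟩ := exists_nat_ge ((M : ℝ) / (2 * (edgeExpansion G + 1 - j)) + 1)
  refine ⟨C, fun Z D hZ0 hstep => exists_charged_of_weight hR hRG hZ0
    (fun x => (G.degree x : ℝ) - edgeExpansion G) ?_ ?_ ?_ ?_ hC⟩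
  · exact fun x => sub_nonneg.2 (edgeExpansion_le_degree x)
  · intro x
    have h1 : (G.degree x : ℝ) ≤ M := by exact_mod_cast hM x
    have h2 := edgeExpansion_nonneg (G := G)
    linarith
  · linarith
  · intro s K hK
    exact degree_weight_growth fun x hx =>
      (Finset.card_le_card (neighborFinset_sdiff_subset hx)).trans_lt
        (hstep x s (hK x hx).1 (hK x hx).2)

/-- A boundary vertex of `K` is either a zero neighbour, in `P`, or one of the at most `(j - 1) |K|`
neighbours outside `P`. Hence `|P| ≥ (1 + Φ_V - j) |K|`, and the constant weight grows with `κ = Φ_V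
- j`. -/
theorem exists_charged_of_vertexExpansion {R : V × ℕ → V × ℕ → Prop}
    (hR : ∀ a b, R a b → R b a) (hRG : ∀ x y s, G.Adj x y → R (x, s + 1) (y, s)) {j : ℕ}
    (hj : (j : ℝ) < vertexExpansion G) :
    ∃ C : ℕ, ∀ Z D : Set (V × ℕ), (∀ x, (x, 0) ∉ Z) →
      (∀ x s, (x, s + 1) ∈ Z → (x, s + 1) ∉ D → (nbrsIn G Zᶜ x s).card < j) →
      ∀ p ∈ Z, ∃ B, p ∈ B ∧ Charged R D C B := by
  obtain ⟨C, hC⟩ := exists_nat_ge (1 / (vertexExpansion G - j) + 1)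
  refine ⟨C, fun Z D hZ0 hstep => exists_charged_of_weight hR hRG hZ0
    (fun _ => 1) (fun _ => zero_le_one) (fun _ => le_rfl) (sub_pos.2 hj) ?_ hC⟩
  intro s K hK
  set P := K.biUnion (nbrsIn G Z · s) with hP
  have h1 := vertexExpansion_mul_card_le (G := G) K
  have h2 : (K.biUnion (G.neighborFinset ·) \ K).card ≤
      P.card + ∑ x ∈ K, (G.neighborFinset x \ P).card := by
    refine (Finset.card_le_card (t := P ∪ K.biUnion fun x => G.neighborFinset x \ P) ?_).trans
      ((Finset.card_union_le _ _).trans (Nat.add_le_add_left Finset.card_biUnion_le _))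
    intro y hy
    obtain ⟨x, hx, hxy⟩ := Finset.mem_biUnion.1 (Finset.mem_sdiff.1 hy).1
    by_cases hyP : y ∈ P
    · exact Finset.mem_union_left _ hyP
    · exact Finset.mem_union_right _
        (Finset.mem_biUnion.2 ⟨x, hx, Finset.mem_sdiff.2 ⟨hxy, hyP⟩⟩)
  have h3 : ∑ x ∈ K, (G.neighborFinset x \ P).card + K.card ≤ j * K.card := by
    rw [Finset.card_eq_sum_ones, ← Finset.sum_add_distrib, Finset.mul_sum]
    refine Finset.sum_le_sum fun x hx => ?_
    have : (G.neighborFinset x \ P).card < j :=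
      (Finset.card_le_card (neighborFinset_sdiff_subset hx)).trans_lt (hstep x s (hK x hx).1 (hK x hx).2)
    omega
  rify at h2 h3
  simp only [Finset.sum_const, nsmul_eq_mul, mul_one]
  nlinarith

end Expansion

/-! ### Distances and clusters in the strong product. -/

section SpaceTime

variable {V : Type*} (G : SimpleGraph V)

/-- Two space-time points are near each other if their distance in `G ⊠ ℕ` is at most `2`. -/
def Near (a b : V × ℕ) : Prop :=
  (∃ z, (a.1 = z ∨ G.Adj a.1 z) ∧ (z = b.1 ∨ G.Adj z b.1)) ∧ a.2 ≤ b.2 + 2 ∧ b.2 ≤ a.2 + 2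

variable {G}

theorem Near.symm {a b : V × ℕ} (h : Near G a b) : Near G b a := by
  obtain ⟨⟨z, h1, h2⟩, h3, h4⟩ := h
  refine ⟨⟨z, ?_, ?_⟩, h4, h3⟩
  · exact h2.imp Eq.symm (·.symm)
  · exact h1.imp Eq.symm (·.symm)

theorem near_of_adj {x y : V} {s t : ℕ} (h : G.Adj x y) (h1 : s ≤ t + 2) (h2 : t ≤ s + 2) :
    Near G (x, s) (y, t) := ⟨⟨x, Or.inl rfl, Or.inr h⟩, h1, h2⟩

theorem near_of_eq {x : V} {s t : ℕ} (h1 : s ≤ t + 2) (h2 : t ≤ s + 2) :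
    Near G (x, s) (x, t) := ⟨⟨x, Or.inl rfl, Or.inl rfl⟩, h1, h2⟩

theorem near_of_adj_adj {x y z : V} {s t : ℕ} (h : G.Adj x y) (h' : G.Adj y z) (h1 : s ≤ t + 2)
    (h2 : t ≤ s + 2) : Near G (x, s) (z, t) := ⟨⟨y, Or.inr h, Or.inr h'⟩, h1, h2⟩

theorem near_of_spaceTime_adj {a b : V × ℕ} (h : (spaceTime G).Adj a b) : Near G a b := by
  obtain ⟨x, s⟩ := a
  obtain ⟨y, t⟩ := b
  simp only [spaceTime, strongProduct, SimpleGraph.hasse_adj, Order.covBy_iff_add_one_eq] at h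
  rcases h with ⟨rfl, h⟩ | ⟨h, rfl⟩ | ⟨h, h'⟩
  · exact near_of_eq (by omega) (by omega)
  · exact near_of_adj h (by omega) (by omega)
  · exact near_of_adj h (by omega) (by omega)

theorem edist_spaceTime_le_one {x y : V} {s t : ℕ} (h : x = y ∨ G.Adj x y) (h1 : s ≤ t + 1)
    (h2 : t ≤ s + 1) : (spaceTime G).edist (x, s) (y, t) ≤ 1 := by
  by_cases heq : (x, s) = (y, t)
  · rw [heq, SimpleGraph.edist_self]; exact zero_le
  · refine (SimpleGraph.edist_eq_one_iff_adj.2 ?_).le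
    simp only [spaceTime, strongProduct, SimpleGraph.hasse_adj, Order.covBy_iff_add_one_eq]
    simp only [Prod.mk.injEq, not_and] at heq
    rcases h with rfl | h
    · exact Or.inl ⟨rfl, by have := heq rfl; omega⟩
    · by_cases hst : s = t
      · exact Or.inr (Or.inl ⟨h, hst⟩)
      · exact Or.inr (Or.inr ⟨h, by omega⟩)

theorem Near.edist_le {a b : V × ℕ} (h : Near G a b) : (spaceTime G).edist a b ≤ 2 := by
  obtain ⟨⟨z, h1, h2⟩, h3, h4⟩ := h
  obtain ⟨m, hm⟩ : ∃ m : ℕ, a.2 ≤ m + 1 ∧ m ≤ a.2 + 1 ∧ m ≤ b.2 + 1 ∧ b.2 ≤ m + 1 :=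
    ⟨(a.2 + b.2) / 2, by omega, by omega, by omega, by omega⟩
  refine ((spaceTime G).edist_triangle (v := (z, m))).trans ?_
  calc _ ≤ (1 : ℕ∞) + 1 := add_le_add (edist_spaceTime_le_one h1 hm.1 hm.2.1)
        (edist_spaceTime_le_one h2 hm.2.2.1 hm.2.2.2)
    _ = 2 := by norm_num

theorem edist_le_of_isChain {l : List (V × ℕ)} {p q : V × ℕ} (hl : (p :: l).IsChain (Near G))
    (hq : q ∈ p :: l) : (spaceTime G).edist p q ≤ ((2 * l.length : ℕ) : ℕ∞) := by
  induction l generalizing p with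
  | nil =>
    obtain rfl : q = p := by simpa using hq
    simp
  | cons a l ih =>
    rw [List.isChain_cons_cons] at hl
    rcases List.mem_cons.1 hq with rfl | hq
    · simp
    · calc (spaceTime G).edist p q ≤ (spaceTime G).edist p a + (spaceTime G).edist a q :=
          SimpleGraph.edist_triangle
        _ ≤ 2 + ((2 * l.length : ℕ) : ℕ∞) := add_le_add hl.1.edist_le (ih hl.2 hq)
        _ = ((2 * (l.length + 1) : ℕ) : ℕ∞) := by push_cast; ring

/-- The covering walk has `2 * (B.card - 1)` steps, each of length at most 2. -/
theorem edist_le_of_linked {B : Finset (V × ℕ)} (hB : Linked (Near G) (B : Set (V × ℕ)))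
    {p q : V × ℕ} (hp : p ∈ B) (hq : q ∈ B) :
    (spaceTime G).edist p q ≤ ((4 * (B.card - 1) : ℕ) : ℕ∞) := by
  obtain ⟨l, h1, h2, h3⟩ := hB.exists_covering_walk (fun _ _ h => h.symm) hp
  have := edist_le_of_isChain h1 ((h2 q).2 hq)
  rwa [h3, ← mul_assoc] at this

variable (G) in
/-- The set of points near a given space-time point. -/
noncomputable def nearFinset [G.LocallyFinite] (a : V × ℕ) : Finset (V × ℕ) :=
  ((insert a.1 (G.neighborFinset a.1)).biUnion fun z => insert z (G.neighborFinset z)) ×ˢ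
    Finset.Icc (a.2 - 2) (a.2 + 2)

theorem mem_nearFinset [G.LocallyFinite] {a b : V × ℕ} : b ∈ nearFinset G a ↔ Near G a b := by
  simp only [nearFinset, Finset.mem_product, Finset.mem_biUnion, Finset.mem_insert,
    SimpleGraph.mem_neighborFinset, Finset.mem_Icc, Near]
  refine and_congr (exists_congr fun z => and_congr (or_congr eq_comm Iff.rfl)
    (or_congr eq_comm Iff.rfl)) ?_
  omega

theorem card_nearFinset_le [G.LocallyFinite] {M : ℕ} (hM : ∀ x, G.degree x ≤ M) (a : V × ℕ) :
    (nearFinset G a).card ≤ (M + 1) ^ 2 * 5 := by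
  have h : ∀ x, (insert x (G.neighborFinset x)).card ≤ M + 1 := fun x =>
    (Finset.card_insert_le _ _).trans (by
      rw [G.card_neighborFinset_eq_degree]; exact Nat.succ_le_succ (hM x))
  rw [nearFinset, Finset.card_product, pow_two]
  refine Nat.mul_le_mul ?_ ?_
  · refine Finset.card_biUnion_le.trans ((Finset.sum_le_card_nsmul _ _ (M + 1) fun z _ => h z).trans
      ?_)
    exact Nat.mul_le_mul_right _ (h _)
  · rw [Nat.card_Icc]; omega

theorem joinedIn_of_mem_cluster {S Z : Set (V × ℕ)} (hSZ : S ⊆ Z) {p q : V × ℕ}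
    (h : q ∈ cluster (spaceTime G) S p) : JoinedIn (Near G) Z p q := by
  obtain ⟨hp, hq, ⟨w⟩⟩ := h
  suffices ∀ a b : S, ((spaceTime G).induce S).Walk a b → JoinedIn (Near G) Z a b from
    this _ _ w
  intro a b w
  induction w with
  | nil => exact .refl
  | @cons a b c h _ ih =>
    exact JoinedIn.trans (Relation.ReflTransGen.single
      ⟨near_of_spaceTime_adj h, hSZ a.2, hSZ b.2⟩) ih

/-- A cluster of large diameter yields a large charged set. -/
theorem exists_charged_of_le_diam {S Z D : Set (V × ℕ)} (hSZ : S ⊆ Z) {C : ℕ}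
    (hZ : ∀ z ∈ Z, ∃ B, z ∈ B ∧ Charged (Near G) D C B) {p : V × ℕ} {ℓ : ℕ}
    (h : ((ℓ : ℕ∞) : WithBot ℕ∞) ≤ diam (spaceTime G) (cluster (spaceTime G) S p)) :
    ∃ B, p ∈ B ∧ Charged (Near G) D (6 * C) B ∧ ℓ / 8 + 1 ≤ B.card := by
  by_contra! hcon
  have hsmall : ∀ q ∈ cluster (spaceTime G) S p, 8 ≤ ℓ ∧
      (spaceTime G).edist p q ≤ ((4 * (ℓ / 8 - 1) : ℕ) : ℕ∞) := by
    intro q hq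
    have hpZ : p ∈ Z := hSZ (by obtain ⟨hp, -⟩ := hq; exact hp)
    obtain ⟨B, hp, hqB, hB⟩ := exists_charged_of_joined (fun _ _ h => h.symm) hZ hpZ
      (joinedIn_of_mem_cluster hSZ hq)
    have h1 := hcon B hp hB
    have h2 : 0 < B.card := Finset.card_pos.2 ⟨p, hp⟩
    refine ⟨by omega, (edist_le_of_linked hB.1 hp hqB).trans ?_⟩
    exact_mod_cast (by omega : 4 * (B.card - 1) ≤ 4 * (ℓ / 8 - 1))
  rcases (cluster (spaceTime G) S p).eq_empty_or_nonempty with he | ⟨q₀, hq₀⟩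
  · rw [he] at h
    simp [diam] at h
  · have hl := (hsmall q₀ hq₀).1
    -- Two radii around `p`, so the bound is twice that of `hsmall`, and it is smaller than `ℓ`.
    have : diam (spaceTime G) (cluster (spaceTime G) S p) ≤
        (((8 * (ℓ / 8 - 1) : ℕ) : ℕ∞) : WithBot ℕ∞) := by
      refine iSup₂_le fun q hq => iSup₂_le fun q' hq' => ?_
      refine WithBot.coe_le_coe.2 ?_
      refine ((spaceTime G).edist_triangle (v := p)).trans ?_
      rw [SimpleGraph.edist_comm]
      refine (add_le_add (hsmall q hq).2 (hsmall q' hq').2).trans ?_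
      exact_mod_cast (by omega : 4 * (ℓ / 8 - 1) + 4 * (ℓ / 8 - 1) ≤ 8 * (ℓ / 8 - 1))
    have h3 := WithBot.coe_le_coe.1 (h.trans this)
    have h4 : ℓ ≤ 8 * (ℓ / 8 - 1) := by exact_mod_cast h3
    omega

end SpaceTime

/-! ### The probability of prescribed noises. -/

section Noise

variable {V Ω : Type*} [MeasurableSpace Ω] {P : Measure Ω} {L : V × ℕ+ → Ω → ℝ}

theorem IsUniformNoise.measure_lt_le (hL : IsUniformNoise P L) (p : V × ℕ+) (ε : ℝ) :
    P (L p ⁻¹' Set.Iio ε) ≤ ENNReal.ofReal ε := by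
  rw [← Measure.map_apply (hL.measurable p) measurableSet_Iio, hL.uniform p]
  rw [ProbabilityTheory.cond_apply measurableSet_Icc]
  simp only [Real.volume_Icc, sub_zero, ENNReal.ofReal_one, inv_one, one_mul]
  refine (measure_mono (t := Set.Ico 0 ε) fun x hx => ⟨hx.1.1, hx.2⟩).trans ?_
  simp

theorem IsUniformNoise.measure_subset_noiseSet_le (hL : IsUniformNoise P L) (ε : ℝ)
    (S : Finset (V × ℕ)) :
    P {w | (S : Set (V × ℕ)) ⊆ noiseSet ε fun p => L p w} ≤ ENNReal.ofReal ε ^ S.card := by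
  by_cases hS : ∀ p ∈ S, 1 ≤ p.2
  swap
  · push Not at hS
    obtain ⟨p, hp, hp0⟩ := hS
    refine le_trans (le_of_eq ?_) zero_le
    convert measure_empty (μ := P)
    ext w
    simp only [Set.mem_ofPred_eq, Set.mem_empty_iff_false, iff_false]
    intro h
    obtain ⟨s, hs, -⟩ := h hp
    omega
  -- The truncated subtraction is harmless: all times in `S` are now at least 1, as a noise at time
  -- 0 is impossible.
  set f : V × ℕ → V × ℕ+ := fun p => (p.1, (p.2 - 1).succPNat) with hf
  have hinj : Set.InjOn f S := by
    rintro ⟨x, s⟩ hp ⟨y, t⟩ hq h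
    have h1 := hS _ hp
    have h2 := hS _ hq
    simp only [hf, Prod.mk.injEq] at h h1 h2 ⊢
    have := Nat.succPNat_injective h.2
    exact ⟨h.1, by omega⟩
  have hsub : {w | (S : Set (V × ℕ)) ⊆ noiseSet ε fun p => L p w} ⊆
      ⋂ q ∈ S.image f, L q ⁻¹' Set.Iio ε := by
    intro w hw
    simp only [Set.mem_iInter, Finset.mem_image]
    rintro q ⟨p, hp, rfl⟩
    obtain ⟨s, hs, hlt⟩ := hw hp
    have : f p = (p.1, s.succPNat) := by simp [hf, hs]
    rw [this]
    exact hlt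
  refine (measure_mono hsub).trans ?_
  rw [hL.indep.measure_inter_preimage_eq_mul _ fun _ _ => measurableSet_Iio]
  refine (Finset.prod_le_prod' fun q _ => hL.measure_lt_le q ε).trans ?_
  rw [Finset.prod_const, Finset.card_image_of_injOn hinj]

end Noise

/-! ### From charged sets to exponential tails. -/

section Reduction

variable {V : Type*} {G : SimpleGraph V} [G.LocallyFinite]

/-- If every zero of the process is contained in a charged set, then the diameter of the
clusters of zeros has exponential tails. -/
theorem diam_tail_of_charged {M : ℕ} (hM : ∀ x, G.degree x ≤ M) {Ξ : Kind} {j C : ℕ}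
    (hC : ∀ (ε : ℝ) (l : V × ℕ+ → ℝ), ∃ Z, zeroSet G Ξ j ε l ⊆ Z ∧
      ∀ p ∈ Z, ∃ B, p ∈ B ∧ Charged (Near G) (noiseSet ε l) C B) :
    ∃ c : ℝ, 0 < c ∧ ∃ ε₀ : ℝ, 0 < ε₀ ∧
      ∀ (Ω : Type w) [MeasurableSpace Ω] (P : Measure Ω)
        [IsProbabilityMeasure P] (L : V × ℕ+ → Ω → ℝ), IsUniformNoise P L →
        ∀ (x : V) (t : ℕ) (ε : ℝ), 0 ≤ ε → ε ≤ ε₀ → ∀ ℓ : ℕ,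
          P.real {w | ((ℓ : ℕ∞) : WithBot ℕ∞) ≤ diam (spaceTime G)
                (cluster (spaceTime G) (zeroSet G Ξ j ε fun p => L p w) (x, t))} ≤
            ε ^ (c * ((ℓ : ℝ) + 1)) := by
  -- The factor 6 comes from gluing; the added 1 keeps `C'` positive.
  set C' := 6 * C + 1 with hC'
  set M' := (M + 1) ^ 2 * 5 with hM'
  have hM1 : 1 ≤ M' := by have := Nat.one_le_pow 2 (M + 1) (by omega); omega
  have hMpos : (0 : ℝ) < 4 * (M' : ℝ) ^ 2 := by positivity
  set θ : ℝ := (4 * (M' : ℝ) ^ 2)⁻¹ with hθ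
  have hθpos : 0 < θ := inv_pos.2 hMpos
  have hθ1 : θ ≤ 1 := by
    refine inv_le_one_of_one_le₀ ?_
    have : (1 : ℝ) ≤ M' := by exact_mod_cast hM1
    nlinarith
  have hCpos : (0 : ℝ) < C' := by positivity
  -- The Peierls bound is used with `y = ε ^ (1 / (2 * C'))`, which must not exceed `θ`, and with
  -- size `ℓ / 8 + 1 ≥ (ℓ + 1) / 8`; this gives the denominator `2 * 8 * C'`.
  refine ⟨1 / (16 * C'), by positivity, θ ^ (2 * C'), by positivity, ?_⟩
  intro Ω _ P _ L hL x t ε hε0 hε ℓ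
  have hε1 : ε ≤ 1 := hε.trans (pow_le_one₀ hθpos.le hθ1)
  set r : ℝ := ε ^ ((1 : ℝ) / (2 * C')) with hr
  have hr0 : 0 ≤ r := Real.rpow_nonneg hε0 _
  have hrpow : r ^ (2 * C') = ε := by
    rw [hr, ← Real.rpow_natCast, ← Real.rpow_mul hε0]
    push_cast
    rw [one_div_mul_cancel (by positivity), Real.rpow_one]
  have hrθ : r ≤ θ := by
    rw [← hrpow] at hε
    exact le_of_pow_le_pow_left₀ (by omega) hθpos.le hε
  have hmain := measure_charged_le P (nearFinset G)
    (fun a b h => mem_nearFinset.2 (mem_nearFinset.1 h).symm) hM1 (card_nearFinset_le hM) C'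
    (ENNReal.ofReal r) (by
      rw [show (4 : ENNReal) * (M' : ENNReal) ^ 2 = ENNReal.ofReal (4 * (M' : ℝ) ^ 2) by
        rw [ENNReal.ofReal_mul (by norm_num), ENNReal.ofReal_pow (by positivity)]; simp,
        ← ENNReal.ofReal_mul hMpos.le, ← ENNReal.ofReal_one]
      refine ENNReal.ofReal_le_ofReal ?_
      calc 4 * (M' : ℝ) ^ 2 * r ≤ 4 * (M' : ℝ) ^ 2 * θ := by gcongr
        _ = 1 := mul_inv_cancel₀ hMpos.ne')
    (fun w => noiseSet ε fun p => L p w) (fun S => by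
      rw [pow_mul, ← ENNReal.ofReal_pow hr0, hrpow]
      exact hL.measure_subset_noiseSet_le ε S) (x, t) (ℓ / 8 + 1)
  have hsub : {w | ((ℓ : ℕ∞) : WithBot ℕ∞) ≤ diam (spaceTime G)
      (cluster (spaceTime G) (zeroSet G Ξ j ε fun p => L p w) (x, t))} ⊆
      {w | ∃ B : Finset (V × ℕ), (x, t) ∈ B ∧ Charged (fun a b => b ∈ nearFinset G a)
        (noiseSet ε fun p => L p w) C' B ∧ ℓ / 8 + 1 ≤ B.card} := by
    intro w hw
    obtain ⟨Z, hZ, hZC⟩ := hC ε fun p => L p w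
    obtain ⟨B, h1, h2, h3⟩ := exists_charged_of_le_diam hZ hZC hw
    refine ⟨B, h1, ⟨?_, h2.2.trans (Nat.mul_le_mul_right _ (by omega))⟩, h3⟩
    simpa only [mem_nearFinset] using h2.1
  have hexp : r ^ (ℓ / 8 + 1) ≤ ε ^ (1 / (16 * (C' : ℝ)) * ((ℓ : ℝ) + 1)) := by
    rw [hr, ← Real.rpow_natCast, ← Real.rpow_mul hε0]
    refine Real.rpow_le_rpow_of_exponent_ge' hε0 hε1 (by positivity) ?_
    have h1 : (ℓ : ℝ) + 1 ≤ 8 * ((ℓ / 8 + 1 : ℕ) : ℝ) := by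
      exact_mod_cast (by omega : ℓ + 1 ≤ 8 * (ℓ / 8 + 1))
    calc 1 / (16 * (C' : ℝ)) * ((ℓ : ℝ) + 1)
        ≤ 1 / (16 * (C' : ℝ)) * (8 * ((ℓ / 8 + 1 : ℕ) : ℝ)) := by gcongr
      _ = _ := by field_simp; norm_num
  refine le_trans ?_ hexp
  refine ENNReal.toReal_le_of_le_ofReal (by positivity) ?_
  rw [ENNReal.ofReal_pow hr0]
  exact (measure_mono hsub).trans hmain

end Reduction

/-! ### Toom cycles. -/

/-- An arc of a Toom cycle: the explored points, the noises found among them,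
and the point where the arc ends. -/
structure Arc (X : Type*) where
  explored : Finset X
  noises : List X
  tip : X

section Toom

variable {X : Type*} {R : X → X → Prop} {Z D : Set X} {β : X → ℤ} {lev : X → ℕ}

/-- The arc `e` starts at `u`, its explored points link `u` to its tip, and their number is
controlled by the number of noises and the increment of `β`. -/
def Arc.IsFrom (R : X → X → Prop) (β : X → ℤ) (u : X) (e : Arc X) : Prop :=
  Linked R (insert u (insert e.tip (e.explored : Set X))) ∧
    (e.explored.card : ℤ) + β e.tip - β u ≤ 4 * e.noises.length + 3

/-- The arcs of `l` form a path from `u` to `v`. -/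
def ArcPath (R : X → X → Prop) (β : X → ℤ) : X → List (Arc X) → X → Prop
  | u, [], v => u = v
  | u, e :: l, v => e.IsFrom R β u ∧ ArcPath R β e.tip l v

theorem arcPath_append {u v : X} {l₁ l₂ : List (Arc X)} :
    ArcPath R β u (l₁ ++ l₂) v ↔ ∃ m, ArcPath R β u l₁ m ∧ ArcPath R β m l₂ v := by
  induction l₁ generalizing u with
  | nil => simp [ArcPath]
  | cons e l ih => simp [ArcPath, ih, and_assoc]

/-- A closed path of arcs whose tips lie in `Z` and that has passed through `p`. -/
structure IsToomCycle (R : X → X → Prop) (Z D : Set X) (β : X → ℤ) (lev : X → ℕ) (p : X)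
    (l : List (Arc X)) : Prop where
  closed : ∃ u, ArcPath R β u l u
  tip_mem : ∀ e ∈ l, e.tip ∈ Z
  noise_mem : ∀ e ∈ l, ∀ n ∈ e.noises, n ∈ D ∧ n ∈ e.explored
  nodup : (l.flatMap Arc.noises).Nodup
  sep : ∀ n ∈ l.flatMap Arc.noises, ∀ e ∈ l, lev e.tip ≤ lev n ∧ e.tip ≠ n
  visits : ∃ e ∈ l, p ∈ e.explored ∨ p = e.tip

variable {p : X}

theorem IsToomCycle.rotate {l₁ l₂ : List (Arc X)}
    (h : IsToomCycle R Z D β lev p (l₁ ++ l₂)) : IsToomCycle R Z D β lev p (l₂ ++ l₁) := by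
  have hmem : ∀ e, e ∈ l₂ ++ l₁ ↔ e ∈ l₁ ++ l₂ := fun e => by simp [or_comm]
  have hperm : ((l₂ ++ l₁).flatMap Arc.noises).Perm ((l₁ ++ l₂).flatMap Arc.noises) := by
    rw [List.flatMap_append, List.flatMap_append]
    exact List.perm_append_comm
  refine ⟨?_, ?_, ?_, hperm.nodup_iff.2 h.nodup, ?_, ?_⟩
  · obtain ⟨u, hu⟩ := h.closed
    obtain ⟨m, h1, h2⟩ := arcPath_append.1 hu
    exact ⟨m, arcPath_append.2 ⟨u, h2, h1⟩⟩
  · simpa only [hmem] using h.tip_mem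
  · simpa only [hmem] using h.noise_mem
  · simpa only [hmem, hperm.mem_iff] using h.sep
  · simpa only [hmem] using h.visits

theorem IsToomCycle.of_sublist {l l' : List (Arc X)} (h : IsToomCycle R Z D β lev p l)
    (hl : l'.Sublist l) (hc : ∃ u, ArcPath R β u l' u)
    (hv : ∃ e ∈ l', p ∈ e.explored ∨ p = e.tip) : IsToomCycle R Z D β lev p l' := by
  have hsub := hl.subset
  have hflat : (l'.flatMap Arc.noises).Sublist (l.flatMap Arc.noises) := by
    clear hc hv h hsub
    induction hl with
    | slnil => exact .slnil
    | @cons l₁ l₂ a _ ih =>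
      rw [List.flatMap_cons]
      exact ih.trans (List.sublist_append_right _ _)
    | cons_cons _ _ ih =>
      rw [List.flatMap_cons, List.flatMap_cons]
      exact ih.append_left _
  exact ⟨hc, fun e he => h.tip_mem e (hsub he), fun e he => h.noise_mem e (hsub he),
    h.nodup.sublist hflat, fun n hn e he => h.sep n (hflat.subset hn) e (hsub he), hv⟩

/-- The potential that decreases along the exploration. -/
def arcPotential (lev : X → ℕ) (l : List (Arc X)) : ℕ := (l.map fun e => 3 ^ lev e.tip).sum

theorem arcPotential_append (l₁ l₂ : List (Arc X)) :
    arcPotential lev (l₁ ++ l₂) = arcPotential lev l₁ + arcPotential lev l₂ := by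
  simp [arcPotential]

theorem arcPotential_cons (e : Arc X) (l : List (Arc X)) :
    arcPotential lev (e :: l) = 3 ^ lev e.tip + arcPotential lev l := by
  simp [arcPotential]

/-- Repetitions among the tips can be removed by cutting the cycle. -/
theorem IsToomCycle.exists_nodup {l : List (Arc X)} (h : IsToomCycle R Z D β lev p l) :
    ∃ l', IsToomCycle R Z D β lev p l' ∧ (l'.map Arc.tip).Nodup ∧
      arcPotential lev l' ≤ arcPotential lev l := by
  induction hn : l.length using Nat.strong_induction_on generalizing l with
  | _ n ih =>
    subst hn
    by_cases hnd : (l.map Arc.tip).Nodup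
    · exact ⟨l, h, hnd, le_rfl⟩
    obtain ⟨a, b, c, e₁, e₂, rfl, htip⟩ : ∃ (a b c : List (Arc X)) (e₁ e₂ : Arc X),
        l = a ++ (e₁ :: (b ++ e₂ :: c)) ∧ e₁.tip = e₂.tip := by
      clear ih h
      induction l with
      | nil => simp at hnd
      | cons e l ihl =>
        rw [List.map_cons, List.nodup_cons] at hnd
        by_cases he : e.tip ∈ l.map Arc.tip
        · obtain ⟨e₂, he₂, h2⟩ := List.mem_map.1 he
          obtain ⟨b, c, rfl⟩ := List.mem_iff_append.1 he₂
          exact ⟨[], b, c, e, e₂, rfl, h2.symm⟩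
        · obtain ⟨a, b, c, e₁, e₂, rfl, h2⟩ := ihl fun h => hnd ⟨he, h⟩
          exact ⟨e :: a, b, c, e₁, e₂, rfl, h2⟩
    obtain ⟨u, hu⟩ := h.closed
    obtain ⟨m, hua, hm⟩ := arcPath_append.1 hu
    obtain ⟨he₁, hm⟩ := hm
    obtain ⟨m', hb, he₂, hc⟩ := arcPath_append.1 hm
    -- Cutting at the common tip gives two closed paths that share out the arcs; the one that has
    -- visited `p` is kept.
    have hc1 : ArcPath R β e₂.tip (b ++ [e₂]) e₂.tip :=
      arcPath_append.2 ⟨m', htip ▸ hb, he₂, rfl⟩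
    have hc2 : ArcPath R β u (a ++ e₁ :: c) u :=
      arcPath_append.2 ⟨m, hua, he₁, htip ▸ hc⟩
    have hs1 : (b ++ [e₂]).Sublist (a ++ (e₁ :: (b ++ e₂ :: c))) := by
      refine List.Sublist.trans ?_ (List.sublist_append_right _ _)
      refine List.Sublist.cons _ (List.Sublist.append_left ?_ _)
      exact List.Sublist.cons_cons _ (List.nil_sublist _)
    have hs2 : (a ++ e₁ :: c).Sublist (a ++ (e₁ :: (b ++ e₂ :: c))) := by
      refine List.Sublist.append_left (List.Sublist.cons_cons _ ?_) _
      exact (List.sublist_cons_self _ _).trans (List.sublist_append_right _ _)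
    have hp1 : arcPotential lev (b ++ [e₂]) ≤ arcPotential lev (a ++ (e₁ :: (b ++ e₂ :: c))) :=
      (hs1.map _).sum_le_sum fun _ _ => Nat.zero_le _
    have hp2 : arcPotential lev (a ++ e₁ :: c) ≤ arcPotential lev (a ++ (e₁ :: (b ++ e₂ :: c))) :=
      (hs2.map _).sum_le_sum fun _ _ => Nat.zero_le _
    obtain ⟨e, he, hpe⟩ := h.visits
    have he' : e ∈ b ++ [e₂] ∨ e ∈ a ++ e₁ :: c := by
      simp only [List.mem_append, List.mem_cons, List.not_mem_nil, or_false] at he ⊢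
      tauto
    rcases he' with he' | he'
    · obtain ⟨l', h1, h2, h3⟩ := ih _ (by simp; omega)
        (h.of_sublist hs1 ⟨_, hc1⟩ ⟨e, he', hpe⟩) rfl
      exact ⟨l', h1, h2, h3.trans hp1⟩
    · obtain ⟨l', h1, h2, h3⟩ := ih _ (by simp)
        (h.of_sublist hs2 ⟨_, hc2⟩ ⟨e, he', hpe⟩) rfl
      exact ⟨l', h1, h2, h3.trans hp2⟩

/-- The newly explored point is paid for by the drop of `β` at the tip; in
`Arc.IsFrom.extend_source` it is paid for by the rise of `β` at the source. -/
theorem Arc.IsFrom.extend_tip (hR : ∀ a b, R a b → R b a) {u x : X} {e : Arc X}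
    (h : e.IsFrom R β u) (hx : R e.tip x) (hβ : β x = β e.tip - 1) :
    (Arc.mk (insert e.tip e.explored) e.noises x).IsFrom R β u := by
  refine ⟨?_, ?_⟩
  · rw [Finset.coe_insert, Set.insert_comm]
    exact h.1.insert_of_rel hR (Set.mem_insert_of_mem _ (Set.mem_insert _ _)) (hR _ _ hx)
  · have h1 := h.2
    have h2 := Finset.card_insert_le e.tip e.explored
    simp only [hβ]
    zify at h2
    linarith

theorem Arc.IsFrom.extend_source (hR : ∀ a b, R a b → R b a) {u x : X} {e : Arc X}
    (h : e.IsFrom R β u) (hx : R u x) (hβ : β x = β u + 1) :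
    (Arc.mk (insert u e.explored) e.noises e.tip).IsFrom R β x := by
  refine ⟨?_, ?_⟩
  · rw [Finset.coe_insert, Set.insert_comm e.tip u]
    exact h.1.insert_of_rel hR (Set.mem_insert _ _) (hR _ _ hx)
  · have h1 := h.2
    have h2 := Finset.card_insert_le u e.explored
    simp only [hβ]
    zify at h2
    linarith

/-- The increments of `β` telescope, and the constants fit: `3 + 3 + 1 = 4 + 3`, where the 1 is the
joining point and the 4 its noise. -/
theorem Arc.IsFrom.merge (hR : ∀ a b, R a b → R b a) {u : X} {e f : Arc X}
    (he : e.IsFrom R β u) (hf : f.IsFrom R β e.tip) :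
    (Arc.mk (e.explored ∪ insert e.tip f.explored) (e.noises ++ e.tip :: f.noises) f.tip).IsFrom
      R β u := by
  refine ⟨?_, ?_⟩
  · convert he.1.union hR hf.1 (c := e.tip) (by simp) (by simp) using 1
    ext z
    simp only [Finset.coe_union, Finset.coe_insert, Set.mem_insert_iff, Set.mem_union]
    tauto
  · have h1 := he.2
    have h2 := hf.2
    have h3 := Finset.card_union_le e.explored (insert e.tip f.explored)
    have h4 := Finset.card_insert_le e.tip f.explored
    simp only [List.length_append, List.length_cons]
    push_cast
    zify at h3 h4
    linarith

/-- A tip of maximal level is treated at each step. If it is not a noise, the incoming arc moves on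
to its `φ₁`-ancestor, the outgoing arc starts from its `φ₂`-ancestor, and a short arc joins the two.
If it is a noise, its two arcs merge. The potential decreases, and the process ends with a single
closed arc at a noise, where `β` cancels. -/
theorem IsToomCycle.exists_charged (hR : ∀ a b, R a b → R b a) (φ₁ φ₂ : X → X)
    (h₁ : ∀ a ∈ Z, a ∉ D → φ₁ a ∈ Z ∧ R a (φ₁ a) ∧ lev (φ₁ a) + 1 = lev a ∧ β (φ₁ a) = β a - 1)
    (h₂ : ∀ a ∈ Z, a ∉ D → φ₂ a ∈ Z ∧ R a (φ₂ a) ∧ lev (φ₂ a) + 1 = lev a ∧ β (φ₂ a) = β a + 1)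
    {l : List (Arc X)} (h : IsToomCycle R Z D β lev p l) : ∃ B, p ∈ B ∧ Charged R D 4 B := by
  induction hn : arcPotential lev l using Nat.strong_induction_on generalizing l with
  | _ n ih =>
    subst hn
    obtain ⟨l', h', hnd', hpot'⟩ := h.exists_nodup
    -- rotate the cycle so that it starts with an arc whose tip has maximal level
    obtain ⟨e, m, hc, hnd, hpot, hmax⟩ : ∃ (e : Arc X) (m : List (Arc X)),
        IsToomCycle R Z D β lev p (e :: m) ∧ ((e :: m).map Arc.tip).Nodup ∧
        arcPotential lev (e :: m) ≤ arcPotential lev l ∧ ∀ f ∈ m, lev f.tip ≤ lev e.tip := by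
      obtain ⟨e₀, he₀, -⟩ := h'.visits
      obtain ⟨e, he, hemax⟩ := Finset.exists_max_image l'.toFinset (fun e => lev e.tip)
        ⟨e₀, List.mem_toFinset.2 he₀⟩
      obtain ⟨a, b, rfl⟩ := List.mem_iff_append.1 (List.mem_toFinset.1 he)
      refine ⟨e, b ++ a, by simpa using h'.rotate, ?_, ?_, ?_⟩
      · have : ((e :: (b ++ a)).map Arc.tip).Perm ((a ++ e :: b).map Arc.tip) := by
          refine List.Perm.map _ ?_
          rw [← List.cons_append]
          exact List.perm_append_comm
        exact this.nodup_iff.2 hnd'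
      · simp only [arcPotential_append, arcPotential_cons] at hpot' ⊢
        omega
      · intro f hf
        refine hemax f (List.mem_toFinset.2 ?_)
        simp only [List.mem_append, List.mem_cons] at hf ⊢
        tauto
    clear h' hnd' hpot' l'
    obtain ⟨u, hu, hm⟩ := hc.closed
    have heZ := hc.tip_mem e (by simp)
    rw [List.map_cons, List.nodup_cons] at hnd
    by_cases heD : e.tip ∈ D
    -- By `sep` a recorded noise is never a tip again, so this noise is new.
    · have hfresh : e.tip ∉ (e :: m).flatMap Arc.noises := fun hmem =>
        (hc.sep _ hmem e (by simp)).2 rfl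
      cases m with
      | nil =>
        obtain rfl : e.tip = u := hm
        refine ⟨insert e.tip e.explored, ?_, ?_, ?_⟩
        · obtain ⟨f, hf, hpf⟩ := hc.visits
          obtain rfl : f = e := by simpa using hf
          rw [Finset.mem_insert]
          exact hpf.symm
        · have := hu.1
          rw [Set.insert_eq_of_mem (Set.mem_insert _ _)] at this
          simpa using this
        · have h1 : (e.tip :: e.noises).length ≤
              ((insert e.tip e.explored).filter (· ∈ D)).card := by
            rw [← List.toFinset_card_of_nodup (l := e.tip :: e.noises)]
            · refine Finset.card_le_card fun z hz => ?_
              rw [List.mem_toFinset, List.mem_cons] at hz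
              rw [Finset.mem_filter, Finset.mem_insert]
              rcases hz with rfl | hz
              · exact ⟨Or.inl rfl, heD⟩
              · have := hc.noise_mem e (by simp) z hz
                exact ⟨Or.inr this.2, this.1⟩
            · rw [List.nodup_cons]
              exact ⟨by simpa using hfresh, by simpa using hc.nodup⟩
          have h2 := hu.2
          have h3 := Finset.card_insert_le e.tip e.explored
          rw [List.length_cons] at h1
          omega
      | cons f m =>
        obtain ⟨hf, hm⟩ := hm
        have hflat : ((Arc.mk (e.explored ∪ insert e.tip f.explored)
            (e.noises ++ e.tip :: f.noises) f.tip :: m).flatMap Arc.noises).Perm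
            (e.tip :: (e :: f :: m).flatMap Arc.noises) := by
          simp only [List.flatMap_cons, List.append_assoc, List.cons_append]
          exact List.perm_middle
        refine ih _ ?_ (l := Arc.mk (e.explored ∪ insert e.tip f.explored)
          (e.noises ++ e.tip :: f.noises) f.tip :: m) ⟨⟨u, hu.merge hR hf, hm⟩, ?_, ?_, ?_, ?_, ?_⟩ rfl
        · simp only [arcPotential_cons] at hpot ⊢
          have : 0 < 3 ^ lev e.tip := by positivity
          omega
        · intro g hg
          rcases List.mem_cons.1 hg with rfl | hg
          · exact hc.tip_mem f (by simp)
          · exact hc.tip_mem g (by simp [hg])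
        · intro g hg
          rcases List.mem_cons.1 hg with rfl | hg
          · intro k hk
            simp only [List.mem_append, List.mem_cons] at hk
            simp only [Finset.mem_union, Finset.mem_insert]
            rcases hk with hk | rfl | hk
            · have := hc.noise_mem e (by simp) k hk; tauto
            · tauto
            · have := hc.noise_mem f (by simp) k hk; tauto
          · exact hc.noise_mem g (by simp [hg])
        · rw [hflat.nodup_iff, List.nodup_cons]
          exact ⟨hfresh, hc.nodup⟩
        · intro k hk g hg
          -- The remaining tips are old ones other than `e.tip`. Maximality of its level and
          -- distinctness of the tips give `sep` for the new noise.
          obtain ⟨g', hg', hgt⟩ : ∃ g' ∈ f :: m, g'.tip = g.tip := by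
            rcases List.mem_cons.1 hg with rfl | hg
            · exact ⟨f, by simp, rfl⟩
            · exact ⟨g, by simp [hg], rfl⟩
          rw [← hgt]
          rw [hflat.mem_iff, List.mem_cons] at hk
          rcases hk with rfl | hk
          · exact ⟨hmax g' hg', fun heq => hnd.1 (List.mem_map.2 ⟨g', hg', heq⟩)⟩
          · exact hc.sep k hk g' (List.mem_cons_of_mem _ hg')
        · obtain ⟨g, hg, hpg⟩ := hc.visits
          simp only [List.mem_cons] at hg
          rcases hg with rfl | rfl | hg
          · refine ⟨_, List.mem_cons_self, Or.inl ?_⟩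
            simp only [Finset.mem_union, Finset.mem_insert]
            tauto
          · refine ⟨_, List.mem_cons_self, ?_⟩
            simp only [Finset.mem_union, Finset.mem_insert]
            tauto
          · exact ⟨g, List.mem_cons_of_mem _ hg, hpg⟩
    · obtain ⟨hZ₁, hR₁, hl₁, hβ₁⟩ := h₁ _ heZ heD
      obtain ⟨hZ₂, hR₂, hl₂, hβ₂⟩ := h₂ _ heZ heD
      -- The base 3 makes two tips one level lower cheaper than the tip they replace.
      have hpow : 3 ^ lev (φ₁ e.tip) + 3 ^ lev (φ₂ e.tip) < 3 ^ lev e.tip := by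
        have : lev (φ₂ e.tip) = lev (φ₁ e.tip) := by omega
        rw [this, ← hl₁, pow_succ]
        have : 0 < 3 ^ lev (φ₁ e.tip) := by positivity
        omega
      -- One explored point and an increment 2 of `β`: the origin of the constant 3 in `Arc.IsFrom`.
      have hmid : (Arc.mk {e.tip} [] (φ₂ e.tip)).IsFrom R β (φ₁ e.tip) := by
        refine ⟨?_, ?_⟩
        · have h1 : Linked R {φ₂ e.tip, e.tip} := linked_pair hR (hR _ _ hR₂)
          simpa using h1.insert_of_rel hR (Set.mem_insert_of_mem _ rfl) (hR _ _ hR₁)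
        · simp only [Finset.card_singleton, List.length_nil, hβ₁, hβ₂]
          push_cast
          linarith
      have hsep : ∀ k ∈ (e :: m).flatMap Arc.noises, (lev (φ₁ e.tip) ≤ lev k ∧ φ₁ e.tip ≠ k) ∧
          lev (φ₂ e.tip) ≤ lev k ∧ φ₂ e.tip ≠ k := by
        intro k hk
        have h1 := (hc.sep k hk e (by simp)).1
        refine ⟨⟨by omega, ?_⟩, by omega, ?_⟩ <;> rintro rfl <;> omega
      cases m with
      | nil =>
        obtain rfl : e.tip = u := hm
        refine ih _ ?_ (l := [Arc.mk {e.tip} [] (φ₂ e.tip),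
          Arc.mk (insert e.tip e.explored) e.noises (φ₁ e.tip)])
          ⟨⟨φ₁ e.tip, hmid, ?_, rfl⟩, ?_, ?_, ?_, ?_, ?_⟩ rfl
        · simp only [arcPotential_cons] at hpot ⊢
          omega
        · have h1 := hu.extend_tip hR hR₁ hβ₁
          have h2 := h1.extend_source hR hR₂ hβ₂
          simpa using h2
        · simp [hZ₁, hZ₂]
        · have := hc.noise_mem e (by simp)
          simp only [List.mem_cons, List.not_mem_nil, or_false, forall_eq_or_imp, forall_eq,
            false_imp_iff, implies_true, true_and, Finset.mem_insert]
          exact fun k hk => ⟨(this k hk).1, Or.inr (this k hk).2⟩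
        · simpa using hc.nodup
        · intro k hk g hg
          have hk' := hsep k (by simpa using hk)
          simp only [List.mem_cons, List.not_mem_nil, or_false] at hg
          rcases hg with rfl | rfl
          · exact hk'.2
          · exact hk'.1
        · obtain ⟨g, hg, hpg⟩ := hc.visits
          obtain rfl : g = e := by simpa using hg
          exact ⟨Arc.mk (insert g.tip g.explored) g.noises (φ₁ g.tip), by simp, Or.inl
            (Finset.mem_insert.2 hpg.symm)⟩
      | cons f m =>
        obtain ⟨hf, hm⟩ := hm
        have hflat : (Arc.mk (insert e.tip e.explored) e.noises (φ₁ e.tip) ::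
            Arc.mk {e.tip} [] (φ₂ e.tip) ::
            Arc.mk (insert e.tip f.explored) f.noises f.tip :: m).flatMap Arc.noises =
            (e :: f :: m).flatMap Arc.noises := by
          simp [List.flatMap_cons]
        refine ih _ ?_ (l := Arc.mk (insert e.tip e.explored) e.noises (φ₁ e.tip) ::
          Arc.mk {e.tip} [] (φ₂ e.tip) :: Arc.mk (insert e.tip f.explored) f.noises f.tip :: m)
          ⟨⟨u, hu.extend_tip hR hR₁ hβ₁, hmid, hf.extend_source hR hR₂ hβ₂, hm⟩, ?_, ?_, ?_, ?_, ?_⟩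
          rfl
        · simp only [arcPotential_cons] at hpot ⊢
          omega
        · intro g hg
          simp only [List.mem_cons] at hg
          rcases hg with rfl | rfl | rfl | hg
          · exact hZ₁
          · exact hZ₂
          · exact hc.tip_mem f (by simp)
          · exact hc.tip_mem g (by simp [hg])
        · intro g hg k hk
          simp only [List.mem_cons] at hg
          rcases hg with rfl | rfl | rfl | hg
          · have := hc.noise_mem e (by simp) k hk
            exact ⟨this.1, Finset.mem_insert_of_mem this.2⟩
          · simp at hk
          · have := hc.noise_mem f (by simp) k hk
            exact ⟨this.1, Finset.mem_insert_of_mem this.2⟩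
          · exact hc.noise_mem g (by simp [hg]) k hk
        · rw [hflat]
          exact hc.nodup
        · intro k hk g hg
          rw [hflat] at hk
          simp only [List.mem_cons] at hg
          rcases hg with rfl | rfl | rfl | hg
          · exact (hsep k hk).1
          · exact (hsep k hk).2
          · exact hc.sep k hk f (by simp)
          · exact hc.sep k hk g (by simp [hg])
        · obtain ⟨g, hg, hpg⟩ := hc.visits
          simp only [List.mem_cons] at hg
          rcases hg with rfl | rfl | hg
          · exact ⟨_, List.mem_cons_self, Or.inl (Finset.mem_insert.2 hpg.symm)⟩
          · refine ⟨Arc.mk (insert e.tip g.explored) g.noises g.tip, by simp, ?_⟩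
            exact hpg.imp (fun h => Finset.mem_insert_of_mem h) id
          · exact ⟨g, by simp [hg], hpg⟩

/-- If each point of `Z` outside `D` has two points of `Z` one level below that move apart with
respect to `β`, then the points of `Z` are contained in charged sets. -/
theorem exists_charged_of_two_charges (hR : ∀ a b, R a b → R b a) (φ₁ φ₂ : X → X)
    (h₁ : ∀ a ∈ Z, a ∉ D → φ₁ a ∈ Z ∧ R a (φ₁ a) ∧ lev (φ₁ a) + 1 = lev a ∧ β (φ₁ a) = β a - 1)
    (h₂ : ∀ a ∈ Z, a ∉ D → φ₂ a ∈ Z ∧ R a (φ₂ a) ∧ lev (φ₂ a) + 1 = lev a ∧ β (φ₂ a) = β a + 1) :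
    ∀ p ∈ Z, ∃ B, p ∈ B ∧ Charged R D 4 B := by
  intro p hp
  refine IsToomCycle.exists_charged hR φ₁ φ₂ h₁ h₂ (l := [Arc.mk ∅ [] p])
    ⟨⟨p, ⟨?_, ?_⟩, rfl⟩, ?_, ?_, ?_, ?_, ?_⟩
  · simpa using linked_singleton (R := R) p
  · simp
  · simpa using hp
  · simp
  · simp
  · simp
  · exact ⟨_, List.mem_cons_self, Or.inr rfl⟩

end Toom

/-! ### Bootstrap percolation below the outward degree. -/

section JBar

variable {V : Type*} {G : SimpleGraph V} [G.LocallyFinite]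

theorem exists_root_of_le_jBar {j : ℕ} (hj1 : 1 ≤ j) (hj : j ≤ jBar G) :
    ∃ r : V, ∀ x, j ≤ ((G.neighborFinset x).filter fun y => G.dist r y = G.dist r x + 1).card := by
  set S := {j : ℕ | ∃ r : V, ∀ k : ℕ, ∀ x ∈ sphere G r k,
    j ≤ (sphere G r (k + 1) ∩ G.neighborSet x).ncard} with hS
  have hmem : jBar G ∈ S := by
    by_cases hb : S.Nonempty ∧ BddAbove S
    · exact Nat.sSup_mem hb.1 hb.2
    · rw [not_and_or, Set.not_nonempty_iff_eq_empty] at hb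
      -- The supremum in `ℕ` of an empty or unbounded set is 0, which `1 ≤ j ≤ jBar G` rules out.
      have h0 : jBar G = 0 := by
        rcases hb with hb | hb
        · rw [jBar, ← hS, hb]; simp
        · exact Nat.sSup_of_not_bddAbove hb
      omega
  obtain ⟨r, hr⟩ := hmem
  refine ⟨r, fun x => hj.trans ((hr _ x rfl).trans ?_)⟩
  rw [← Set.ncard_coe_finset]
  refine Set.ncard_le_ncard ?_ (Finset.finite_toSet _)
  rintro y ⟨hy, hxy⟩
  simpa using ⟨hxy, hy⟩

/-- A noiseless zero was already a zero, and since fewer than `j` neighbours were ones, some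
neighbour farther from the root was a zero too. These are the two ancestors for the Toom cycle. -/
theorem exists_charged_of_le_jBar {j : ℕ} (hj1 : 1 ≤ j) (hj : j ≤ jBar G) (ε : ℝ)
    (l : V × ℕ+ → ℝ) : ∀ p ∈ zeroSet G .bootstrap j ε l,
      ∃ B, p ∈ B ∧ Charged (Near G) (noiseSet ε l) 4 B := by
  obtain ⟨r, hr⟩ := exists_root_of_le_jBar hj1 hj
  set Z := zeroSet G .bootstrap j ε l
  have hstep : ∀ x s, (x, s + 1) ∈ Z → (x, s + 1) ∉ noiseSet ε l →
      ∃ y, G.Adj x y ∧ G.dist r y = G.dist r x + 1 ∧ (y, s) ∈ Z := by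
    intro x s hz hn
    by_contra! hcon
    have h1 := card_ones_lt hz hn
    refine absurd ((hr x).trans (Finset.card_le_card fun y hy => ?_)) (not_le.2 h1)
    rw [Finset.mem_filter, SimpleGraph.mem_neighborFinset] at hy
    exact mem_nbrsIn.2 ⟨hy.1, hcon y hy.1 hy.2⟩
  choose! f hf using hstep
  -- Back in time, staying changes `β` by `-1` and moving outwards by `2 - 1 = 1`.
  refine exists_charged_of_two_charges (lev := Prod.snd)
    (β := fun a => 2 * (G.dist r a.1 : ℤ) + a.2) (fun _ _ h => h.symm)
    (fun a => (a.1, a.2 - 1)) (fun a => (f a.1 (a.2 - 1), a.2 - 1)) ?_ ?_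
  · rintro ⟨x, t⟩ hz hn
    cases t with
    | zero => exact absurd hz (zero_notMem_zeroSet _ _ _ _ _)
    | succ s =>
      refine ⟨zero_of_bootstrap hz hn, near_of_eq (by simp) (by simp; omega), rfl, ?_⟩
      simp only [Nat.add_sub_cancel]
      push_cast; ring
  · rintro ⟨x, t⟩ hz hn
    cases t with
    | zero => exact absurd hz (zero_notMem_zeroSet _ _ _ _ _)
    | succ s =>
      obtain ⟨h1, h2, h3⟩ := hf x s hz hn
      refine ⟨h3, near_of_adj h1 (by simp) (by simp; omega), rfl, ?_⟩
      simp only [Nat.add_sub_cancel, h2]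
      push_cast; ring

end JBar

/-! ### Paths and separating vertices. -/

section Paths

variable {V : Type*} {G : SimpleGraph V}

theorem fin_two_eq_of_ne {a b c : Fin 2} (h : a ≠ b) (h' : b ≠ c) : a = c := by
  revert a b c; decide

/-- An inner point of a path splits it into two shorter paths. -/
theorem exists_split {a b v : V} (p : G.Walk a b) (hv : v ∈ p.support) (hva : v ≠ a)
    (hvb : v ≠ b) : ∃ (u₁ u₂ : V) (p₁ : G.Walk a u₁) (h₁ : G.Adj u₁ v) (h₂ : G.Adj v u₂)
      (p₂ : G.Walk u₂ b), p = p₁.append (.cons h₁ (.cons h₂ p₂)) := by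
  induction p with
  | nil => simp at hv; exact absurd hv hva
  | @cons a c b h p ih =>
    rw [SimpleGraph.Walk.support_cons, List.mem_cons] at hv
    rcases hv with rfl | hv
    · exact absurd rfl hva
    by_cases hvc : v = c
    · subst hvc
      cases p with
      | nil => exact absurd rfl hvb
      | cons h₂ p₂ => exact ⟨a, _, .nil, h, h₂, p₂, rfl⟩
    · obtain ⟨u₁, u₂, p₁, h₁, h₂, p₂, rfl⟩ := ih hv hvc hvb
      exact ⟨u₁, u₂, .cons h p₁, h₁, h₂, p₂, rfl⟩

/-- Every walk from `a` to `b` passes through `v`. -/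
def Separates (G : SimpleGraph V) (v a b : V) : Prop := ∀ w : G.Walk a b, v ∈ w.support

theorem separates_of_mem_path (hG : G.IsAcyclic) {a b v : V} {p : G.Walk a b} (hp : p.IsPath)
    (hv : v ∈ p.support) : Separates G v a b := by
  intro w
  have h := hG.subsingleton_path a b |>.elim ⟨p, hp⟩ w.toPath
  refine w.support_toPath_subset_support ?_
  rw [← h]
  exact hv

theorem Separates.of_adj {v a a' b b' : V} (h : Separates G v a b) (ha : G.Adj a a')
    (hb : G.Adj b b') (hva : v ≠ a) (hvb : v ≠ b) : Separates G v a' b' := by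
  intro w
  have := h (.cons ha (w.concat hb.symm))
  simp only [SimpleGraph.Walk.support_cons, SimpleGraph.Walk.support_concat, List.mem_cons,
    List.mem_append, List.not_mem_nil, or_false] at this
  tauto

end Paths

/-! ### Rows of zeros on regular trees. -/

section Tree

variable {V : Type*} {G : SimpleGraph V} {Z D : Set (V × ℕ)}

/-- There is a path in `Z`, going back in time, from `a` at time `q.2 + k` to `q`. -/
def Descends (G : SimpleGraph V) (Z : Set (V × ℕ)) (q : V × ℕ) : ℕ → V → Prop
  | 0, a => a = q.1 ∧ q ∈ Z
  | k + 1, a => (a, q.2 + k + 1) ∈ Z ∧ ∃ y, G.Adj a y ∧ Descends G Z q k y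

theorem Descends.reachable {q : V × ℕ} {k : ℕ} {a : V} (h : Descends G Z q k a) :
    G.Reachable a q.1 := by
  induction k generalizing a with
  | zero => obtain ⟨rfl, -⟩ := h; exact .refl _
  | succ k ih =>
    obtain ⟨-, y, hay, hy⟩ := h
    exact hay.reachable.trans (ih hy)

/-- If one can descend from `a` and from `b` to the same point, then `Z` contains the path
from `a` to `b` with each second point shifted back by one time step. -/
theorem Descends.separator_mem (hG : G.IsAcyclic) (c : G.Coloring (Fin 2))
    (h2 : ∀ x y y' t, y ≠ y' → G.Adj x y → G.Adj x y' → (y, t) ∈ Z → (y', t) ∈ Z →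
      (x, t + 1) ∈ Z) {q : V × ℕ} {k : ℕ} {a b : V}
    (ha : Descends G Z q k a) (hb : Descends G Z q k b) :
    c a = c b ∧ ∀ v, Separates G v a b → (c v = c a → (v, q.2 + k) ∈ Z) ∧
      (c v ≠ c a → ∃ t, q.2 + k = t + 1 ∧ (v, t) ∈ Z) := by
  induction k generalizing a b with
  | zero =>
    obtain ⟨rfl, hq⟩ := ha
    obtain ⟨rfl, -⟩ := hb
    refine ⟨rfl, fun v hv => ?_⟩
    obtain rfl : v = q.1 := by simpa using hv .nil
    exact ⟨fun _ => hq, fun h => absurd rfl h⟩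
  | succ k ih =>
    obtain ⟨haZ, a', haa, ha'⟩ := ha
    obtain ⟨hbZ, b', hbb, hb'⟩ := hb
    obtain ⟨hc, ih⟩ := ih ha' hb'
    have hca := c.valid haa
    have hcb := c.valid hbb
    have hcab : c a = c b := fin_two_eq_of_ne hca (hc ▸ hcb.symm)
    refine ⟨hcab, fun v hv => ?_⟩
    by_cases hva : v = a
    · subst hva; exact ⟨fun _ => haZ, fun h => absurd rfl h⟩
    by_cases hvb : v = b
    · subst hvb; exact ⟨fun _ => hbZ, fun h => absurd hcab.symm h⟩
    have hv' := hv.of_adj haa hbb hva hvb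
    -- A point with the colour of `a` lies between two distinct points of the path from `a'` to `b'`
    -- that are in `Z` one step earlier, so `h2` applies. A point of the other colour is covered by
    -- the induction hypothesis directly.
    constructor
    · intro hcv
      have hcv' : c v ≠ c a' := hcv ▸ hca
      have hne : v ≠ a' := fun h => hcv' (by rw [h])
      have hne' : v ≠ b' := fun h => hcv' (by rw [h, hc])
      obtain ⟨w⟩ := ha'.reachable.trans hb'.reachable.symm
      obtain ⟨p, hp⟩ := w.toPath
      obtain ⟨u₁, u₂, p₁, h₁, h₂, p₂, rfl⟩ := exists_split p (hv' p) hne hne'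
      have hu₁ := (ih u₁ (separates_of_mem_path hG hp (by simp))).1
        (fin_two_eq_of_ne (c.valid h₁) hcv')
      have hu₂ := (ih u₂ (separates_of_mem_path hG hp (by simp))).1
        (fin_two_eq_of_ne (c.valid h₂).symm hcv')
      refine h2 v u₁ u₂ _ ?_ h₁.symm h₂ hu₁ hu₂
      rintro rfl
      have := hp.support_nodup
      rw [SimpleGraph.Walk.support_append] at this
      simp only [SimpleGraph.Walk.support_cons, List.tail_cons] at this
      exact List.disjoint_of_nodup_append this p₁.end_mem_support
        (List.mem_cons_of_mem _ p₂.start_mem_support)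
    · intro hcv
      exact ⟨q.2 + k, rfl, (ih v hv').1 (fin_two_eq_of_ne hcv hca)⟩

/-- `B` is a linked set that contains the end points of a row of length `L`, that can be reached
from the points of `A` at time `s`, and that has many noises. -/
structure RowCover (G : SimpleGraph V) (Z D : Set (V × ℕ)) (s : ℕ) (a b : V) (A : Set V) (L : ℕ)
    (B : Finset (V × ℕ)) : Prop where
  left_mem : (a, s) ∈ B
  right_mem : (b, s) ∈ B
  linked : Linked (Near G) (B : Set (V × ℕ))
  descends : ∀ q ∈ B, ∃ v ∈ A, ∃ k, s = q.2 + k ∧ Descends G Z q k v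
  card_le : B.card + L + 2 ≤ 3 * (B.filter (· ∈ D)).card

/-- The case of equality `1 + 0 + 2 = 3` in `card_le`. -/
theorem rowCover_singleton {s : ℕ} {a : V} (hZ : (a, s) ∈ Z) (hD : (a, s) ∈ D) :
    RowCover G Z D s a a {a} 0 {(a, s)} where
  left_mem := by simp
  right_mem := by simp
  linked := by simpa using linked_singleton _
  descends q hq := by
    obtain rfl := Finset.mem_singleton.1 hq
    exact ⟨a, rfl, 0, rfl, rfl, hZ⟩
  card_le := by
    rw [Finset.filter_singleton, if_pos hD]; simp

theorem RowCover.mono {s : ℕ} {a b : V} {A A' : Set V} {L : ℕ} {B : Finset (V × ℕ)}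
    (h : RowCover G Z D s a b A L B) (hA : A ⊆ A') : RowCover G Z D s a b A' L B where
  left_mem := h.left_mem
  right_mem := h.right_mem
  linked := h.linked
  descends q hq := by
    obtain ⟨v, hv, k⟩ := h.descends q hq
    exact ⟨v, hA hv, k⟩
  card_le := h.card_le

theorem RowCover.reverse {s : ℕ} {a b : V} {A : Set V} {L : ℕ} {B : Finset (V × ℕ)}
    (h : RowCover G Z D s a b A L B) : RowCover G Z D s b a A L B where
  left_mem := h.right_mem
  right_mem := h.left_mem
  linked := h.linked
  descends := h.descends
  card_le := h.card_le

/-- The two constants 2 in `card_le` pay for the new one and for the two edges through `v`. The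
pieces end two edges apart, which is why `Near` allows distance 2. -/
theorem RowCover.glue {s : ℕ} {a b u₁ u₂ v : V} {A₁ A₂ : Set V} {L₁ L₂ : ℕ}
    {B₁ B₂ : Finset (V × ℕ)} (h₁ : RowCover G Z D s a u₁ A₁ L₁ B₁)
    (h₂ : RowCover G Z D s u₂ b A₂ L₂ B₂) (hd : Disjoint B₁ B₂) (hv₁ : G.Adj u₁ v)
    (hv₂ : G.Adj v u₂) : RowCover G Z D s a b (A₁ ∪ A₂) (L₁ + L₂ + 2) (B₁ ∪ B₂) where
  left_mem := Finset.mem_union_left _ h₁.left_mem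
  right_mem := Finset.mem_union_right _ h₂.right_mem
  linked := by
    rw [Finset.coe_union]
    exact h₁.linked.union_of_rel (fun _ _ h => h.symm) h₂.linked h₁.right_mem h₂.left_mem
      (near_of_adj_adj hv₁ hv₂ (by omega) (by omega))
  descends q hq := by
    rcases Finset.mem_union.1 hq with hq | hq
    · obtain ⟨w, hw, k⟩ := h₁.descends q hq
      exact ⟨w, Or.inl hw, k⟩
    · obtain ⟨w, hw, k⟩ := h₂.descends q hq
      exact ⟨w, Or.inr hw, k⟩
  card_le := by
    rw [Finset.card_union_of_disjoint hd, Finset.filter_union,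
      Finset.card_union_of_disjoint (Finset.disjoint_filter_filter hd)]
    have := h₁.card_le
    have := h₂.card_le
    omega

/-- A row whose end points carry no noise and whose inner points of the other color are zeros one
time step before extends to a longer row at that time. -/
theorem exists_extension (hG : G.IsAcyclic) {a b : V} {p : G.Walk a b} (hp : p.IsPath) {N : V → Prop}
    (ha : ∃ y y', y ≠ y' ∧ G.Adj a y ∧ G.Adj a y' ∧ N y ∧ N y')
    (hb : ∃ y y', y ≠ y' ∧ G.Adj b y ∧ G.Adj b y' ∧ N y ∧ N y') :
    ∃ (z z' : V) (hz : G.Adj z a) (hz' : G.Adj b z'), N z ∧ N z' ∧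
      (SimpleGraph.Walk.cons hz (p.concat hz')).IsPath := by
  have hpath : ∀ (z z' : V) (hz : G.Adj z a) (hz' : G.Adj b z'), z ≠ z' → z ∉ p.support →
      z' ∉ p.support → (SimpleGraph.Walk.cons hz (p.concat hz')).IsPath := by
    intro z z' hz hz' hne h h'
    rw [SimpleGraph.Walk.cons_isPath_iff, SimpleGraph.Walk.concat_isPath_iff,
      SimpleGraph.Walk.support_concat]
    refine ⟨⟨hp, h'⟩, ?_⟩
    simp only [List.mem_append, List.mem_singleton]
    tauto
  by_cases hab : a = b
  · subst hab
    obtain ⟨y, y', hne, hy, hy', hN, hN'⟩ := ha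
    have hnil : p.support = [a] := by
      rwa [SimpleGraph.Walk.isPath_iff_nil, SimpleGraph.Walk.nil_iff_support_eq] at hp
    refine ⟨y, y', hy.symm, hy', hN, hN', hpath _ _ _ _ hne ?_ ?_⟩
    · rw [hnil, List.mem_singleton]; exact hy.ne'
    · rw [hnil, List.mem_singleton]; exact hy'.ne'
  -- In an acyclic graph an end point has at most one neighbour on the path, so one of the two
  -- candidates lies off it. The new ends differ, since otherwise they would close a cycle with the
  -- path.
  · obtain ⟨z, hz, hNz, hzp⟩ : ∃ z, G.Adj a z ∧ N z ∧ z ∉ p.support := by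
      obtain ⟨y, y', hne, hy, hy', hN, hN'⟩ := ha
      by_contra! hcon
      exact hne ((hG.eq_snd_of_adj_start hp hy (hcon y hy hN)).trans
        (hG.eq_snd_of_adj_start hp hy' (hcon y' hy' hN')).symm)
    obtain ⟨z', hz', hNz', hzp'⟩ : ∃ z, G.Adj b z ∧ N z ∧ z ∉ p.support := by
      obtain ⟨y, y', hne, hy, hy', hN, hN'⟩ := hb
      by_contra! hcon
      exact hne ((hG.eq_penultimate_of_adj_end hp hy (hcon y hy hN)).trans
        (hG.eq_penultimate_of_adj_end hp hy' (hcon y' hy' hN')).symm)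
    refine ⟨z, z', hz.symm, hz', hNz, hNz', hpath _ _ _ _ ?_ hzp hzp'⟩
    rintro rfl
    have hq : (SimpleGraph.Walk.cons hz.symm p).IsPath :=
      (SimpleGraph.Walk.cons_isPath_iff _ _).2 ⟨hp, hzp⟩
    have h := hG.subsingleton_path z b |>.elim ⟨_, hq⟩ (.singleton hz'.symm)
    have := congrArg (fun w : G.Path z b => (w : G.Walk z b).length) h
    simp only [SimpleGraph.Walk.length_cons, SimpleGraph.Path.singleton_coe] at this
    have h0 : p.length = 0 := by simpa using this
    exact hab (SimpleGraph.Walk.eq_of_length_eq_zero h0)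

theorem exists_rowCover (hG : G.IsAcyclic) (c : G.Coloring (Fin 2)) (h0 : ∀ x, (x, 0) ∉ Z)
    (h1 : ∀ x t, (x, t + 1) ∈ Z → (x, t + 1) ∉ D →
      ∃ y y', y ≠ y' ∧ G.Adj x y ∧ G.Adj x y' ∧ (y, t) ∈ Z ∧ (y', t) ∈ Z)
    (h2 : ∀ x y y' t, y ≠ y' → G.Adj x y → G.Adj x y' → (y, t) ∈ Z → (y', t) ∈ Z →
      (x, t + 1) ∈ Z) (s : ℕ) {a b : V} (p : G.Walk a b) (hp : p.IsPath) (hab : c a = c b)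
    (hrow : ∀ v ∈ p.support, c v = c a → (v, s) ∈ Z) :
    ∃ B, RowCover G Z D s a b {v | v ∈ p.support ∧ c v = c a} p.length B := by
  induction s generalizing a b with
  | zero => exact absurd (hrow a p.start_mem_support rfl) (h0 a)
  | succ t iht =>
    induction hL : p.length using Nat.strong_induction_on generalizing a b with
    | _ L ihL =>
    subst hL
    by_cases hodd : ∀ v ∈ p.support, c v ≠ c a → (v, t) ∈ Z
    swap
    · -- the row splits at a point that is not a zero one time step before
      push Not at hodd
      obtain ⟨v, hv, hcv, hvt⟩ := hodd
      obtain ⟨u₁, u₂, p₁, hu₁, hu₂, p₂, rfl⟩ := exists_split p hv (fun h => hcv (by rw [h]))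
        (fun h => hcv (by rw [h, hab]))
      have hsep : Separates G v a b := separates_of_mem_path hG hp (by simp)
      have hcu₁ : c u₁ = c a := fin_two_eq_of_ne (c.valid hu₁) hcv
      have hcu₂ : c u₂ = c a := fin_two_eq_of_ne (c.valid hu₂).symm hcv
      have hsup : (p₁.append (.cons hu₁ (.cons hu₂ p₂))).support =
          p₁.support ++ v :: p₂.support := by
        rw [SimpleGraph.Walk.support_append]; rfl
      have hnd := hp.support_nodup
      rw [hsup, List.nodup_append] at hnd
      have hv₁ : v ∉ p₁.support := fun h => hnd.2.2 v h v (by simp) rfl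
      have hv₂ : v ∉ p₂.support := (List.nodup_cons.1 hnd.2.1).1
      have hp₁ : p₁.IsPath := .mk' hnd.1
      have hp₂ : p₂.IsPath := .mk' (List.nodup_cons.1 hnd.2.1).2
      have hsub₁ : ∀ w ∈ p₁.support,
          w ∈ (p₁.append (.cons hu₁ (.cons hu₂ p₂))).support := by
        intro w hw; rw [hsup]; simp [hw]
      have hsub₂ : ∀ w ∈ p₂.support,
          w ∈ (p₁.append (.cons hu₁ (.cons hu₂ p₂))).support := by
        intro w hw; rw [hsup]; simp [hw]
      obtain ⟨B₁, hB₁⟩ := ihL p₁.length (by simp) p₁ hp₁ hcu₁.symm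
        (fun w hw hcw => hrow w (hsub₁ w hw) hcw) rfl
      obtain ⟨B₂, hB₂⟩ := ihL p₂.length (by simp; omega) p₂ hp₂ (hcu₂.trans hab)
        (fun w hw hcw => hrow w (hsub₂ w hw) (hcw.trans hcu₂)) rfl
      -- A common point would be reached by descents from both sides of `v`. Since `v` separates the
      -- two starting points, `Descends.separator_mem` would then make `v` a zero at time `t`.
      have hd : Disjoint B₁ B₂ := by
        rw [Finset.disjoint_left]
        intro q hq₁ hq₂
        obtain ⟨v₁, ⟨hv₁p, hcv₁⟩, k, hk, hdes₁⟩ := hB₁.descends q hq₁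
        obtain ⟨v₂, ⟨hv₂p, -⟩, k', hk', hdes₂⟩ := hB₂.descends q hq₂
        obtain rfl : k = k' := by omega
        have hsep' : Separates G v v₁ v₂ := by
          intro w
          have := hsep ((p₁.takeUntil v₁ hv₁p).append (w.append (p₂.dropUntil v₂ hv₂p)))
          rw [SimpleGraph.Walk.mem_support_append_iff,
            SimpleGraph.Walk.mem_support_append_iff] at this
          rcases this with h | h | h
          · exact absurd (p₁.support_takeUntil_subset_support hv₁p h) hv₁
          · exact h
          · exact absurd (p₂.support_dropUntil_subset_support hv₂p h) hv₂
        obtain ⟨t', ht', hvt'⟩ := ((hdes₁.separator_mem hG c h2 hdes₂).2 v hsep').2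
          (hcv₁.symm ▸ hcv)
        obtain rfl : t = t' := by omega
        exact hvt hvt'
      refine ⟨B₁ ∪ B₂, ?_⟩
      have hlen : (p₁.append (.cons hu₁ (.cons hu₂ p₂))).length = p₁.length + p₂.length + 2 := by
        simp; omega
      rw [hlen]
      refine (hB₁.glue hB₂ hd hu₁ hu₂).mono ?_
      rintro w (⟨hw, hcw⟩ | ⟨hw, hcw⟩)
      · exact ⟨hsub₁ w hw, hcw⟩
      · exact ⟨hsub₂ w hw, hcw.trans hcu₂⟩
    -- a noise at an end point is split off
    have hend : ∀ {a' b' : V} (p' : G.Walk a' b'), p'.IsPath → c a' = c b' →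
        p'.length = p.length → (∀ v ∈ p'.support, c v = c a' → (v, t + 1) ∈ Z) →
        (a', t + 1) ∈ D →
        ∃ B, RowCover G Z D (t + 1) a' b' {v | v ∈ p'.support ∧ c v = c a'} p'.length B := by
      intro a' b' p' hp' hab' hlen hrow' haD
      cases p' with
      | nil =>
        refine ⟨{(a', t + 1)}, (rowCover_singleton (hrow' a' (by simp) rfl) haD).mono ?_⟩
        rintro w rfl
        simp
      | cons h p' =>
        cases p' with
        | nil => exact absurd hab' (c.valid h)
        | @cons _ u _ h' p₂ =>
          rw [SimpleGraph.Walk.cons_isPath_iff, SimpleGraph.Walk.cons_isPath_iff] at hp'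
          have hcu : c a' = c u := fin_two_eq_of_ne (c.valid h) (c.valid h')
          simp only [SimpleGraph.Walk.support_cons, List.mem_cons, not_or] at hp' hrow'
          simp only [SimpleGraph.Walk.length_cons] at hlen
          obtain ⟨B₂, hB₂⟩ := ihL p₂.length (by omega) p₂ hp'.1.1 (hcu.symm.trans hab')
            (fun w hw hcw => hrow' w (by tauto) (hcw.trans hcu.symm)) rfl
          have hd : Disjoint {(a', t + 1)} B₂ := by
            rw [Finset.disjoint_singleton_left]
            intro hmem
            obtain ⟨w, ⟨hw, -⟩, k, hk, hdes⟩ := hB₂.descends _ hmem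
            obtain rfl : k = 0 := by simpa using hk
            obtain rfl : w = a' := hdes.1
            exact hp'.2.2 hw
          refine ⟨{(a', t + 1)} ∪ B₂, ?_⟩
          have := (rowCover_singleton (hrow' a' (by simp) rfl) haD).glue hB₂ hd h h'
          rw [zero_add] at this
          refine this.mono ?_
          rintro w (rfl | ⟨hw, hcw⟩)
          · simp
          · exact ⟨by simp [hw], hcw.trans hcu.symm⟩
    by_cases haD : (a, t + 1) ∈ D
    · exact hend p hp hab rfl hrow haD
    by_cases hbD : (b, t + 1) ∈ D
    · obtain ⟨B, hB⟩ := hend p.reverse hp.reverse hab.symm (by simp)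
        (by simpa [hab] using hrow) hbD
      refine ⟨B, ?_⟩
      simpa [hab] using hB.reverse
    -- otherwise the row extends one time step before
    obtain ⟨z, z', hz, hz', hzZ, hzZ', hpath⟩ := exists_extension hG hp (N := fun y => (y, t) ∈ Z)
      (h1 a t (hrow a p.start_mem_support rfl) haD)
      (h1 b t (hrow b p.end_mem_support hab.symm) hbD)
    have hcz := c.valid hz
    have hcz' := c.valid hz'
    obtain ⟨B, hB⟩ := iht _ hpath (fin_two_eq_of_ne hcz (hab ▸ hcz')) (by
      intro v hv hcv
      simp only [SimpleGraph.Walk.support_cons, SimpleGraph.Walk.support_concat, List.mem_cons,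
        List.mem_append, List.not_mem_nil, or_false] at hv
      rcases hv with rfl | hv | rfl
      · exact hzZ
      · exact hodd v hv (hcv ▸ hcz)
      · exact hzZ')
    -- The earlier row is longer by two, which pays for the two points added here.
    refine ⟨insert (a, t + 1) (insert (b, t + 1) B), ?_, ?_, ?_, ?_, ?_⟩
    · simp
    · simp
    · rw [Finset.coe_insert, Finset.coe_insert]
      have hsymm : ∀ x y : V × ℕ, Near G x y → Near G y x := fun _ _ h => h.symm
      refine (hB.linked.insert_of_rel hsymm hB.right_mem ?_).insert_of_rel hsymm
        (Set.mem_insert_of_mem _ hB.left_mem) ?_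
      · exact near_of_adj hz' (by omega) (by omega)
      · exact near_of_adj hz.symm (by omega) (by omega)
    · intro q hq
      rw [Finset.mem_insert, Finset.mem_insert] at hq
      rcases hq with rfl | rfl | hq
      · exact ⟨a, ⟨p.start_mem_support, rfl⟩, 0, rfl, rfl, hrow a p.start_mem_support rfl⟩
      · exact ⟨b, ⟨p.end_mem_support, hab.symm⟩, 0, rfl, rfl,
          hrow b p.end_mem_support hab.symm⟩
      · obtain ⟨v, ⟨hv, hcv⟩, k, hk, hdes⟩ := hB.descends q hq
        suffices ∃ w ∈ p.support, c w = c a ∧ G.Adj w v by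
          obtain ⟨w, hw, hcw, hwv⟩ := this
          refine ⟨w, ⟨hw, hcw⟩, k + 1, by omega, ?_, v, hwv, hdes⟩
          rw [← hk]
          exact hrow w hw hcw
        simp only [SimpleGraph.Walk.support_cons, SimpleGraph.Walk.support_concat, List.mem_cons,
          List.mem_append, List.not_mem_nil, or_false] at hv
        rcases hv with rfl | hv | rfl
        · exact ⟨a, p.start_mem_support, rfl, hz.symm⟩
        · have hcv' : c v ≠ c a := hcv ▸ hcz
          obtain ⟨u₁, u₂, p₁, hu₁, hu₂, p₂, rfl⟩ := exists_split p hv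
            (fun h => hcv' (by rw [h])) (fun h => hcv' (by rw [h, hab]))
          exact ⟨u₁, by simp, fin_two_eq_of_ne (c.valid hu₁) hcv', hu₁⟩
        · exact ⟨b, p.end_mem_support, hab.symm, hz'⟩
    · have h3 := hB.card_le
      have h4 : (B.filter (· ∈ D)).card ≤
          ((insert (a, t + 1) (insert (b, t + 1) B)).filter (· ∈ D)).card :=
        Finset.card_le_card (Finset.filter_subset_filter _
          ((Finset.subset_insert _ _).trans (Finset.subset_insert _ _)))
      have h5 := Finset.card_insert_le (b, t + 1) B
      have h6 := Finset.card_insert_le (a, t + 1) (insert (b, t + 1) B)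
      simp only [SimpleGraph.Walk.length_cons, SimpleGraph.Walk.length_concat] at h3
      omega

/-- The zeros of the Consensus Process on a regular tree with threshold below the degree are
contained in charged sets. -/
theorem exists_charged_of_tree [G.LocallyFinite] (hG : G.IsTree) {d j : ℕ} (hd : 2 ≤ d)
    (hreg : G.IsRegularOfDegree d) (hj : j < d) (ε : ℝ) (l : V × ℕ+ → ℝ) :
    ∃ Z, zeroSet G .consensus j ε l ⊆ Z ∧
      ∀ p ∈ Z, ∃ B, p ∈ B ∧ Charged (Near G) (noiseSet ε l) 3 B := by
  -- At threshold `d - 1` fewer than `d - 1` ones among `d` neighbours means at least two zeros.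
  -- Having this in both directions is what the row argument needs.
  refine ⟨zeroSet G .consensus (d - 1) ε l, zeroSet_consensus_mono (by omega) ε l, ?_⟩
  set Z := zeroSet G .consensus (d - 1) ε l
  have hcard : ∀ x s, (nbrsIn G Z x s).card + (nbrsIn G Zᶜ x s).card = d := by
    intro x s
    rw [← hreg x, ← G.card_neighborFinset_eq_degree]
    convert Finset.card_filter_add_card_filter_not (s := G.neighborFinset x) fun y => (y, s) ∈ Z
      <;> (ext; simp [mem_nbrsIn])
  obtain ⟨c⟩ := hG.colorable_two
  rintro ⟨x, s⟩ hx
  obtain ⟨B, hB⟩ := exists_rowCover (Z := Z) (D := noiseSet ε l) hG.isAcyclic c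
    (zero_notMem_zeroSet _ _ _ _) (by
      intro x t hx hn
      have h1 : (nbrsIn G Zᶜ x t).card < d - 1 := card_ones_lt hx hn
      have h2 := hcard x t
      obtain ⟨y, hy, y', hy', hne⟩ := Finset.one_lt_card.1 (by omega : 1 < (nbrsIn G Z x t).card)
      rw [mem_nbrsIn] at hy hy'
      exact ⟨y, y', hne, hy.1, hy'.1, hy.2, hy'.2⟩)
    (by
      intro x y y' t hne hy hy' hyZ hyZ'
      refine mem_zeroSet_consensus_succ.2 (Or.inr ?_)
      have h1 : 1 < (nbrsIn G Z x t).card :=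
        Finset.one_lt_card.2 ⟨y, mem_nbrsIn.2 ⟨hy, hyZ⟩, y', mem_nbrsIn.2 ⟨hy', hyZ'⟩, hne⟩
      have h2 := hcard x t
      change (nbrsIn G Zᶜ x t).card < d - 1
      omega) s (.nil : G.Walk x x) .nil rfl (by simpa using hx)
  refine ⟨B, hB.left_mem, hB.linked, ?_⟩
  have := hB.card_le
  omega

end Tree

end NoisyThreshold

/-! ### The cases of goodness. -/

theorem proposition2p9 {V : Type*} [Infinite V] (G : SimpleGraph V) [G.LocallyFinite]
    (hconn : G.Connected) (hbdd : BddAbove (Set.range fun x : V => G.degree x))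
    (Ξ : NoisyThreshold.Kind) (j : ℕ) (hj1 : 1 ≤ j) (hj : j ≤ NoisyThreshold.minDeg G)
    (hgood : NoisyThreshold.Good G j Ξ) :
    ∃ c : ℝ, 0 < c ∧ ∃ ε₀ : ℝ, 0 < ε₀ ∧
      ∀ (Ω : Type*) [MeasurableSpace Ω] (P : MeasureTheory.Measure Ω)
        [MeasureTheory.IsProbabilityMeasure P] (L : V × ℕ+ → Ω → ℝ),
        NoisyThreshold.IsUniformNoise P L →
        ∀ (x : V) (t : ℕ) (ε : ℝ), 0 ≤ ε → ε ≤ ε₀ → ∀ ℓ : ℕ,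
          P.real {w | ((ℓ : ℕ∞) : WithBot ℕ∞) ≤
              NoisyThreshold.diam (NoisyThreshold.spaceTime G)
                (NoisyThreshold.cluster (NoisyThreshold.spaceTime G)
                  (NoisyThreshold.zeroSet G Ξ j ε fun p => L p w) (x, t))} ≤
            ε ^ (c * ((ℓ : ℝ) + 1)) := by
  obtain ⟨M, hM⟩ := hbdd
  replace hM : ∀ x, G.degree x ≤ M := fun x => hM ⟨x, rfl⟩
  have hR : ∀ a b, NoisyThreshold.Near G a b → NoisyThreshold.Near G b a := fun _ _ h => h.symm
  have hRG : ∀ x y s, G.Adj x y → NoisyThreshold.Near G (x, s + 1) (y, s) := fun x y s h =>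
    NoisyThreshold.near_of_adj h (by omega) (by omega)
  have hedge : (j : ℝ) < NoisyThreshold.edgeExpansion G + 1 →
      ∃ C, ∀ (ε : ℝ) (l : V × ℕ+ → ℝ), ∃ Z, NoisyThreshold.zeroSet G Ξ j ε l ⊆ Z ∧
        ∀ p ∈ Z, ∃ B, p ∈ B ∧
          NoisyThreshold.Charged (NoisyThreshold.Near G) (NoisyThreshold.noiseSet ε l) C B := by
    intro h
    obtain ⟨C, hC⟩ := NoisyThreshold.exists_charged_of_edgeExpansion hR hRG hM h
    exact ⟨C, fun ε l => ⟨_, subset_rfl, hC _ _ (NoisyThreshold.zero_notMem_zeroSet _ _ _ _)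
      fun x s => NoisyThreshold.card_ones_lt⟩⟩
  suffices ∃ C, ∀ (ε : ℝ) (l : V × ℕ+ → ℝ), ∃ Z, NoisyThreshold.zeroSet G Ξ j ε l ⊆ Z ∧
      ∀ p ∈ Z, ∃ B, p ∈ B ∧
        NoisyThreshold.Charged (NoisyThreshold.Near G) (NoisyThreshold.noiseSet ε l) C B by
    obtain ⟨C, hC⟩ := this
    exact NoisyThreshold.diam_tail_of_charged hM hC
  cases Ξ with
  | bootstrap =>
    rcases hgood with h | h
    · exact hedge h
    · exact ⟨4, fun ε l => ⟨_, subset_rfl, NoisyThreshold.exists_charged_of_le_jBar hj1 h ε l⟩⟩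
  | consensus =>
    rcases hgood with h | ⟨-, h⟩ | h | ⟨d, hd, hG, hreg, hjd⟩
    -- As `Φ_E ≤ Δ`, the condition gives `2 j < 3 Φ_E - Δ + 2 ≤ 2 Φ_E + 2`.
    · refine hedge ?_
      obtain ⟨x⟩ := hconn.nonempty
      have h1 : G.degree x ≤ NoisyThreshold.maxDeg G :=
        le_ciSup (f := fun x => G.degree x) ⟨M, by rintro _ ⟨y, rfl⟩; exact hM y⟩ x
      have h2 : (G.degree x : ℝ) ≤ NoisyThreshold.maxDeg G := by exact_mod_cast h1
      have h3 := NoisyThreshold.edgeExpansion_le_degree (G := G) x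
      linarith
    · exact hedge h
    · obtain ⟨C, hC⟩ := NoisyThreshold.exists_charged_of_vertexExpansion hR hRG h
      exact ⟨C, fun ε l => ⟨_, subset_rfl, hC _ _ (NoisyThreshold.zero_notMem_zeroSet _ _ _ _)
        fun x s => NoisyThreshold.card_ones_lt⟩⟩
    · exact ⟨3, fun ε l => NoisyThreshold.exists_charged_of_tree hG hd hreg hjd ε l⟩
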